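/- **Setting.** Let $d\ge 1$ and $d/2<m_{\min}\le m_{\max}$. *Kernels.* $\{\Phi_m\}_{m\in[m_{\min},m_{\max}]}$ is a family of real translation-invariant kernels on $\mathbb R^d$ whose Fourier transforms satisfy $$c_1(1+\|\omega\|^2)^{-m}\le\widehat\Phi_m(\omega)\le c_2(1+\|\omega\|^2)^{-m}\qquad(\omega\in\mathbb R^d)$$ with constants $0<c_1\le c_2$ that do not depend on $m\in[m_{\min},m_{\max}]$, that is, $\Phi_m(x,z)=(2\pi)^{-d/2}\int_{\mathbb R^d}\widehat\Phi_m(\omega)\,e^{i\langle x-z,\omega\rangle}\,d\omega$ with $\widehat\Phi_m$ real and measurable. (So $\Phi_m$ is symmetric positive definite, and its native space $\mathcal N_{\Phi_m}$, the real reproducing kernel Hilbert space of $\Phi_m$, is norm-equivalent to $H^m(\mathbb R^d)$, uniformly in $m$.) *Data.* $\Omega\subset\mathbb R^d$ is a bounded set, $X\subset\Omega$ is a finite set of at least two points, $q_X=\tfrac12\min_{x\ne y\in X}\|x-y\|$, and $Y\in\mathbb R^X$. The kernel interpolant $u_m$ is the element of $\operatorname{span}\{\Phi_m(\cdot,x):x\in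 X\}$ with $u_m|_X=Y$, and $\eta(m):=\|u_m\|_{\mathcal N_{\Phi_m}}$. *Band-limited functions.* With $\widehat f(\omega)=(2\pi)^{-d/2}\int f(x)e^{-i\langle x,\omega\rangle}dx$ (extended to $L^2$), let $\|f\|_{H^t}^2=\int(1+\|\omega\|^2)^t|\widehat f(\omega)|^2d\omega$. For $\sigma>0$ let $\mathcal B_\sigma$ be the set of $f\in L^2(\mathbb R^d)$ with $\widehat f=0$ almost everywhere outside the ball $\{\|\omega\|\le\sigma\}$; its elements are identified with their continuous representatives. For $t>0$ let $f^*_{\sigma,t}=f^*_{\sigma,t,X,Y}$ be the minimizer of $\|f\|_{H^t}$ among the $f\in\mathcal B_\sigma$ with $f|_X=Y$. For $f\in\mathcal B_\sigma$ the spectral median of order $t$ is $$\beta_t(f)=\max\Bigl\{\theta\in[0,1]:\int_{\theta\le\|\omega\|/\sigma\le1}(1+\|\omega\|^2)^t|\widehat f(\omega)|^2\,d\omega\ \ge\ \tfrac12\|f\|_{H^t}^2\Bigr\}.$$ **Theorem.** There is $\kappa_0>0$, depending only on $d,m_{\min},m_{\max}$, such that for every $\kappa\ge\kappa_0$, every kernel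 family as above, every bounded $\Omega\subset\mathbb R^d$ and every $s>0$ there is a constant $C>0$, independent of $X$, $Y$ and $m$, for which the following holds for all $m\in[m_{\min},m_{\max}]$, all finite $X\subset\Omega$ with at least two points and all $Y\in\mathbb R^X$. Put $\sigma=\kappa/q_X$ and $s_*=\min\{s,m\}$. Then $u_m$ and the minimizers $f^*_{\sigma,t}$ ($t>0$) exist and are unique, the function $t\mapsto\log\bigl(1+(\beta_t(f^*_{\sigma,m})\,\sigma)^2\bigr)$ is integrable on $[s_*,m]$, and $$\eta(m)\ \ge\ C\,\|f^*_{\sigma,s_*}\|_{H^{s_*}(\mathbb R^d)}\,\exp\Bigl(\tfrac14\int_{s_*}^{m}\log\bigl(1+(\beta_t(f^*_{\sigma,m})\,\sigma)^2\bigr)\,dt\Bigr).$$ -/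

import Mathlib

open MeasureTheory

noncomputable section

namespace SobolevProfile

/-- The Euclidean space `ℝ^d`. -/
abbrev Space (d : ℕ) : Type := EuclideanSpace ℝ (Fin d)

/-- The complex Hilbert space `L²(ℝ^d)`. -/
abbrev L2 (d : ℕ) : Type := Lp ℂ 2 (volume : Measure (Space d))

variable {d : ℕ}

/-! ### Fourier transform, Sobolev norms, band-limited functions -/

/-- The unitary Fourier transform on `L²(ℝ^d)` in the angular frequency `ω`, that is, the
`L²`-extension of `f̂(ω) = (2π)^(-d/2) ∫ f(x) exp(-i⟨x, ω⟩) dx`. (Mathlib's transform uses the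
character `exp(-2πi⟨x, ξ⟩)`, so that `f̂(ω) = (2π)^(-d/2) 𝓕 f (ω / 2π)`.) -/
def fhat (f : L2 d) (ω : Space d) : ℂ :=
  (((2 * Real.pi) ^ (-(d : ℝ) / 2) : ℝ) : ℂ) *
    (Lp.fourierTransformₗᵢ (Space d) ℂ f) ((2 * Real.pi)⁻¹ • ω)

/-- The density `(1 + ‖ω‖²)^t |f̂(ω)|²` of the squared `H^t`-norm. -/
def sobolevDensity (t : ℝ) (f : L2 d) (ω : Space d) : ℝ :=
  (1 + ‖ω‖ ^ 2) ^ t * ‖fhat f ω‖ ^ 2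

/-- The Bessel-potential Sobolev norm `‖f‖_{H^t(ℝ^d)}`. It is used only for band-limited `f`, for
which the density is integrable for every real `t`. -/
def sobolevNorm (t : ℝ) (f : L2 d) : ℝ :=
  Real.sqrt (∫ ω, sobolevDensity t f ω)

/-- The band-limited space `B_σ`: the `f ∈ L²(ℝ^d)` with `supp f̂` in the closed ball of radius `σ`
about the origin. -/
def bandLimited (d : ℕ) (σ : ℝ) : Set (L2 d) :=
  {f | ∀ᵐ ω : Space d, σ < ‖ω‖ → fhat f ω = 0}

/-- The spectral shell `{ω : θ ≤ ‖ω‖ / σ ≤ 1}`. -/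
def spectralShell (d : ℕ) (θ σ : ℝ) : Set (Space d) :=
  {ω | θ ≤ ‖ω‖ / σ ∧ ‖ω‖ / σ ≤ 1}

/-- The spectral median `β_t(f)` of `f ∈ B_σ`: the largest `θ ∈ [0, 1]` for which the shell
`θ ≤ ‖ω‖ / σ ≤ 1` carries at least half of `‖f‖²_{H^t}`. The set contains `0`, is bounded by `1`,
and its supremum is attained, so that `sSup` is the maximum. -/
def spectralMedian (σ t : ℝ) (f : L2 d) : ℝ :=
  sSup {θ : ℝ | θ ∈ Set.Icc (0 : ℝ) 1 ∧
    1 / 2 * sobolevNorm t f ^ 2 ≤ ∫ ω in spectralShell d θ σ, sobolevDensity t f ω}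

/-! ### Data and band-limited interpolation -/

/-- The separation distance `q_X = ½ min_{x ≠ y} ‖x - y‖` of a finite set of at least two points. -/
def sepDist (X : Finset (Space d)) : ℝ :=
  1 / 2 * (X : Set (Space d)).infsep

/-- `f|_X = Y` for `f ∈ L²(ℝ^d)`: the continuous representative of `f` takes the values `Y` on `X`.
(Every band-limited function has a continuous representative, and it is unique.) -/
def Interpolates (f : L2 d) (X : Finset (Space d)) (Y : X → ℝ) : Prop :=
  ∃ g : Space d → ℂ, Continuous g ∧ (f : Space d → ℂ) =ᵐ[volume] g ∧
    ∀ x : X, g (x : Space d) = (Y x : ℂ)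

/-- `f = f*_{σ,t,X,Y}`: `f` has the least `H^t`-norm among the functions of `B_σ` that interpolate
the data `(X, Y)`. -/
structure IsMinBandLimited (σ t : ℝ) (X : Finset (Space d)) (Y : X → ℝ) (f : L2 d) : Prop where
  mem : f ∈ bandLimited d σ
  interp : Interpolates f X Y
  le : ∀ g ∈ bandLimited d σ, Interpolates g X Y → sobolevNorm t f ≤ sobolevNorm t g

/-! ### Kernels and native spaces -/

/-- A family of translation-invariant kernels `Φ_m` on `ℝ^d`, `m ∈ I`, whose Fourier transforms
satisfy `c₁ (1 + ‖ω‖²)^(-m) ≤ Φ̂_m(ω) ≤ c₂ (1 + ‖ω‖²)^(-m)` with constants that are uniform over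
`m ∈ I`. As `m > d/2`, the symbol `Φ̂_m` is integrable, and to say that it is the Fourier transform
of `Φ_m` is to say that `Φ_m(x, z) = (2π)^(-d/2) ∫ Φ̂_m(ω) exp(i⟨x - z, ω⟩) dω`. This makes `Φ_m` a
symmetric positive definite kernel whose native space is `H^m(ℝ^d)` with an equivalent norm. -/
structure IsAdmissibleFamily (I : Set ℝ) (c₁ c₂ : ℝ) (Φ : ℝ → Space d → Space d → ℝ) : Prop where
  c₁_pos : 0 < c₁
  c₁_le_c₂ : c₁ ≤ c₂
  fourier_decay : ∀ m ∈ I, ∃ Φhat : Space d → ℝ, Measurable Φhat ∧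
    (∀ ω, c₁ * (1 + ‖ω‖ ^ 2) ^ (-m) ≤ Φhat ω ∧ Φhat ω ≤ c₂ * (1 + ‖ω‖ ^ 2) ^ (-m)) ∧
    ∀ x z, (Φ m x z : ℂ) = (((2 * Real.pi) ^ (-(d : ℝ) / 2) : ℝ) : ℂ) *
      ∫ ω, (Φhat ω : ℂ) * Complex.exp (Complex.I * (inner ℝ (x - z) ω : ℝ))

section Native

variable (N : Type) [NormedAddCommGroup N] [InnerProductSpace ℝ N] [CompleteSpace N]
  [RKHS ℝ N (Space d) ℝ]

/-- `N` is the native space of the kernel `K`: the Hilbert space of real functions on `ℝ^d` with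
reproducing kernel `K`. (It is unique up to a unique isometry that respects point values.) -/
def IsNativeSpace (K : Space d → Space d → ℝ) : Prop :=
  ∀ x z : Space d, RKHS.kernel N x z 1 = K x z

variable {N}

/-- `u` is the kernel interpolant of the data `(X, Y)`: it lies in the trial space
`span {K(·, x) : x ∈ X}`, and `u|_X = Y`. (`RKHS.kerFun N x 1` is the function `K(·, x)`, as an
element of the native space.) -/
structure IsKernelInterpolant (X : Finset (Space d)) (Y : X → ℝ) (u : N) : Prop where
  mem_trial : u ∈ Submodule.span ℝ ((fun x : Space d => RKHS.kerFun N x (1 : ℝ)) '' X)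
  interp : ∀ x : X, u (x : Space d) = Y x

end Native

end SobolevProfile

end

open SobolevProfile

/-!
Write `P(ω) = ∑ c_x exp(i⟨x, ω⟩)` for an exponential sum over the data sites. The quadratic form of
the kernel `Φ_m` at `c` is `(2π)^(-d/2) ∫ Φ̂_m |P|²`, and that of the reproducing kernel of
`(B_σ, H^m)` is `(2π)^(-d) ∫ (1 + ‖ω‖²)^(-m) |P|²` over the ball of radius `σ`. As `X` is
`2 q_X`-separated, exponential sums are nearly orthogonal with respect to Gaussian weights of width
at least a multiple of `1 / q_X` (`exists_gaussian_frame_bounds`): the Gram matrix is diagonally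
dominant by a packing argument. For `σ = κ / q_X` with `κ` large, removing the tail of one Gaussian
bounds `∫ |P|²` over the ball from below, and writing `(1 + ‖ω‖²)^(-m)` at high frequencies as a
mixture of wide Gaussians bounds the rest of the first form from above. So the first form is at most
a constant times the second one, uniformly in `m` and `X` (`exists_lowpass_bound`); here `m > d/2`
makes the mixture converge, and the boundedness of `Ω` keeps `σ` away from `0`.

Minimal norms are dual to these forms. Testing the kernel interpolant `u_m` against the
`Φ_m`-translates with the coefficients of the minimizer `f*_{σ,m}` gives
`‖f*_{σ,m}‖_{H^m} ≤ C ‖u_m‖` (`sobolevNorm_le_sqrt_mul_norm`).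

For a fixed band-limited `f`, the logarithmic derivative of `t ↦ ‖f‖²_{H^t}` is the average of
`log (1 + ‖ω‖²)` with respect to the normalized Sobolev density, hence at least
`½ log (1 + (β_t(f) σ)²)` by the definition of the median. Integration over `[s_*, m]` yields
`sobolevNorm_mul_exp_le`, where the integrand is monotone since the median increases with the order.
With `f = f*_{σ,m}` and the minimality of `f*_{σ,s_*}` in `H^{s_*}`, the two bounds combine.
-/

/-! ### Exponential sums and Gaussian weights -/

/-- The exponential sum `ω ↦ ∑ c_x exp(i⟨x, ω⟩)` with frequencies `x ∈ X` and real coefficients. -/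
noncomputable def expSum {d : ℕ} (X : Finset (Space d)) (c : X → ℝ) (ω : Space d) : ℂ :=
  ∑ x : X, (c x : ℂ) * Complex.exp (Complex.I * (inner ℝ (x : Space d) ω : ℝ))

section ExpSum
variable {d : ℕ} (X : Finset (Space d)) (c : X → ℝ)

@[fun_prop]
lemma continuous_expSum : Continuous (expSum X c) := by
  unfold expSum; fun_prop

lemma norm_expSum_sq (ω : Space d) : ((‖expSum X c ω‖ ^ 2 : ℝ) : ℂ) =
    ∑ x : X, ∑ y : X, ((c x * c y : ℝ) : ℂ) *
      Complex.exp (Complex.I * (inner ℝ ((x : Space d) - y) ω : ℝ)) := by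
  push_cast
  rw [← Complex.mul_conj', expSum, map_sum, Finset.sum_mul_sum]
  refine Finset.sum_congr rfl fun x _ => Finset.sum_congr rfl fun y _ => ?_
  rw [map_mul, Complex.conj_ofReal, ← Complex.exp_conj, map_mul, Complex.conj_I,
    Complex.conj_ofReal, inner_sub_left]
  rw [mul_mul_mul_comm, ← Complex.exp_add]
  push_cast
  ring_nf

lemma norm_expSum_le (ω : Space d) : ‖expSum X c ω‖ ≤ ∑ x : X, |c x| := by
  refine (norm_sum_le _ _).trans (Finset.sum_le_sum fun x _ => ?_)
  rw [norm_mul, mul_comm Complex.I, Complex.norm_exp_ofReal_mul_I]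
  simp

lemma integrable_mul_norm_expSum_sq {w : Space d → ℝ} {μ : Measure (Space d)}
    (hw : Integrable w μ) : Integrable (fun ω => w ω * ‖expSum X c ω‖ ^ 2) μ := by
  refine hw.mul_bdd (c := (∑ x : X, |c x|) ^ 2) (by fun_prop) (.of_forall fun ω => ?_)
  rw [Real.norm_of_nonneg (by positivity)]
  gcongr
  exact norm_expSum_le X c ω

lemma integrable_mul_exp_I {w : Space d → ℝ} {μ : Measure (Space d)}
    (hw : Integrable w μ) (x : Space d) :
    Integrable (fun ω => (w ω : ℂ) * Complex.exp (Complex.I * (inner ℝ x ω : ℝ))) μ := by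
  refine hw.ofReal.mul_bdd (c := 1) (by fun_prop) (.of_forall fun ω => ?_)
  rw [mul_comm Complex.I, Complex.norm_exp_ofReal_mul_I]

/-- The quadratic form of the positive definite function with symbol `w` is the weighted square
integral of the exponential sum. -/
lemma integral_mul_norm_expSum_sq {w : Space d → ℝ} {μ : Measure (Space d)}
    (hw : Integrable w μ) :
    ((∫ ω, w ω * ‖expSum X c ω‖ ^ 2 ∂μ : ℝ) : ℂ) =
      ∑ x : X, ∑ y : X, ((c x * c y : ℝ) : ℂ) *
        ∫ ω, (w ω : ℂ) * Complex.exp (Complex.I * (inner ℝ ((x : Space d) - y) ω : ℝ)) ∂μ := by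
  rw [← integral_complex_ofReal]
  have hi := fun x : Space d => integrable_mul_exp_I hw x
  calc _ = ∫ ω, ∑ x : X, ∑ y : X, ((c x * c y : ℝ) : ℂ) * ((w ω : ℂ) *
        Complex.exp (Complex.I * (inner ℝ ((x : Space d) - y) ω : ℝ))) ∂μ := by
        refine integral_congr_ae (.of_forall fun ω => ?_)
        simp only
        rw [Complex.ofReal_mul, norm_expSum_sq, Finset.mul_sum]
        refine Finset.sum_congr rfl fun x _ => ?_
        rw [Finset.mul_sum]
        refine Finset.sum_congr rfl fun y _ => ?_
        ring
    _ = _ := by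
        rw [integral_finsetSum _ fun x _ => integrable_finsetSum _ fun y _ =>
          (hi _).const_mul _]
        refine Finset.sum_congr rfl fun x _ => ?_
        rw [integral_finsetSum _ fun y _ => (hi _).const_mul _]
        simp_rw [integral_const_mul]

lemma integrable_exp_neg_mul_norm_sq {b : ℝ} (hb : 0 < b) :
    Integrable (fun ω : Space d => Real.exp (-b * ‖ω‖ ^ 2)) := by
  have h := GaussianFourier.integrable_cexp_neg_mul_sq_norm_add (V := Space d) (b := (b : ℂ))
    (by simpa using hb) 0 0
  refine h.norm.congr (.of_forall fun ω => ?_)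
  simp only
  rw [Complex.norm_exp]
  congr 1
  norm_cast
  simp

lemma integral_gaussian_mul_norm_expSum_sq {b : ℝ} (hb : 0 < b) :
    ∫ ω, Real.exp (-b * ‖ω‖ ^ 2) * ‖expSum X c ω‖ ^ 2 =
      (Real.pi / b) ^ ((d : ℝ) / 2) * ∑ x : X, ∑ y : X, c x * c y *
        Real.exp (-(dist (x : Space d) y ^ 2 / (4 * b))) := by
  have h := integral_mul_norm_expSum_sq X c (integrable_exp_neg_mul_norm_sq (d := d) hb)
  rw [← Complex.ofReal_inj, h, Complex.ofReal_mul, Complex.ofReal_sum, Finset.mul_sum]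
  refine Finset.sum_congr rfl fun x _ => ?_
  rw [Complex.ofReal_sum, Finset.mul_sum]
  refine Finset.sum_congr rfl fun y _ => ?_
  have e := GaussianFourier.integral_cexp_neg_mul_sq_norm_add (V := Space d) (b := (b : ℂ))
    (by simpa using hb) Complex.I ((x : Space d) - y)
  have : ∫ ω : Space d, ((Real.exp (-b * ‖ω‖ ^ 2) : ℝ) : ℂ) *
      Complex.exp (Complex.I * (inner ℝ ((x : Space d) - y) ω : ℝ)) =
      (((Real.pi / b) ^ ((d : ℝ) / 2) *
        Real.exp (-(dist (x : Space d) y ^ 2 / (4 * b))) : ℝ) : ℂ) := by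
    rw [Complex.ofReal_mul, Complex.ofReal_cpow (by positivity)]
    convert! e using 2
    · ext ω
      rw [Complex.exp_add]
      push_cast
      rfl
    · simp
    · rw [Complex.ofReal_exp]
      congr 1
      rw [dist_eq_norm]
      push_cast
      rw [Complex.I_sq]
      ring
  rw [this]
  push_cast
  ring
end ExpSum

/-- A packing bound: the Gaussian of width `q` summed over a `2q`-separated set is bounded by a
constant that depends on the dimension only. -/
lemma exists_sum_gaussian_le (d : ℕ) : ∃ M : ℝ, 0 < M ∧ ∀ q : ℝ, 0 < q →
    ∀ X : Finset (Space d), (∀ x ∈ X, ∀ y ∈ X, x ≠ y → 2 * q ≤ dist x y) → ∀ z : Space d,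
      ∑ y ∈ X, Real.exp (-(dist y z ^ 2 / (2 * q ^ 2))) ≤ M := by
  set v : ℝ := (volume (Metric.ball (0 : Space d) 1)).toReal with hv
  have hv0 : 0 < v := ENNReal.toReal_pos (Metric.measure_ball_pos _ _ one_pos).ne'
    measure_ball_lt_top.ne
  refine ⟨Real.exp (1 / 2) * (4 * Real.pi) ^ ((d : ℝ) / 2) / v, by positivity, ?_⟩
  intro q hq X hX z
  rw [le_div_iff₀ hv0]
  -- on the ball of radius `q` about `y`, the value of the Gaussian at `y` is at most that of the
  -- wider Gaussian `g`, and these balls are disjoint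
  set g : Space d → ℝ := fun ω => Real.exp (1 / 2) * Real.exp (-(4 * q ^ 2)⁻¹ * ‖ω - z‖ ^ 2)
  have hg : Integrable g :=
    ((integrable_exp_neg_mul_norm_sq (d := d) (b := (4 * q ^ 2)⁻¹) (by positivity)).comp_sub_right
      z).const_mul _
  have hvol : ∀ y : Space d, (volume (Metric.ball y q)).toReal = q ^ d * v := by
    intro y
    rw [Measure.addHaar_ball_of_pos _ _ hq, ENNReal.toReal_mul, ENNReal.toReal_ofReal (by positivity)]
    simp [hv]
  have hle : ∀ y : Space d, Real.exp (-(dist y z ^ 2 / (2 * q ^ 2))) * (q ^ d * v) ≤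
      ∫ ω in Metric.ball y q, g ω := by
    intro y
    rw [mul_comm, ← hvol y, ← smul_eq_mul, ← Measure.real_def, ← setIntegral_const]
    refine setIntegral_mono_on (integrableOn_const measure_ball_lt_top.ne) hg.integrableOn
      measurableSet_ball fun ω hω => ?_
    simp only [g]
    rw [← Real.exp_add]
    apply Real.exp_le_exp.2
    rw [Metric.mem_ball] at hω
    have h1 : ‖ω - z‖ ≤ dist ω y + dist y z := by rw [← dist_eq_norm]; exact dist_triangle _ _ _
    have h2 : ‖ω - z‖ ^ 2 ≤ 2 * q ^ 2 + 2 * dist y z ^ 2 := by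
      have h3 : ‖ω - z‖ ≤ q + dist y z := by linarith
      have h4 : ‖ω - z‖ ^ 2 ≤ (q + dist y z) ^ 2 := by gcongr
      nlinarith [sq_nonneg (q - dist y z)]
    have h5 : (4 * q ^ 2)⁻¹ * ‖ω - z‖ ^ 2 ≤ (4 * q ^ 2)⁻¹ * (2 * q ^ 2 + 2 * dist y z ^ 2) := by
      gcongr
    have h6 : (4 * q ^ 2)⁻¹ * (2 * q ^ 2 + 2 * dist y z ^ 2) =
      1 / 2 + dist y z ^ 2 / (2 * q ^ 2) := by field_simp; ring
    linarith
  have hdisj : (X : Set (Space d)).PairwiseDisjoint fun y => Metric.ball y q := by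
    intro x hx y hy hxy
    exact Metric.ball_disjoint_ball (by linarith [hX x hx y hy hxy])
  have hsum : (∑ y ∈ X, Real.exp (-(dist y z ^ 2 / (2 * q ^ 2)))) * (q ^ d * v) ≤ ∫ ω, g ω := by
    rw [Finset.sum_mul]
    refine (Finset.sum_le_sum fun y _ => hle y).trans ?_
    rw [← integral_biUnion_finset X (fun _ _ => measurableSet_ball) hdisj
      fun _ _ => hg.integrableOn]
    exact setIntegral_le_integral hg (.of_forall fun ω => by positivity)
  have hint : ∫ ω, g ω = Real.exp (1 / 2) * ((4 * Real.pi) ^ ((d : ℝ) / 2) * q ^ d) := by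
    simp only [g]
    rw [integral_const_mul,
      integral_sub_right_eq_self (fun ω : Space d => Real.exp (-(4 * q ^ 2)⁻¹ * ‖ω‖ ^ 2)) z,
      GaussianFourier.integral_rexp_neg_mul_sq_norm (by positivity)]
    congr 1
    rw [div_inv_eq_mul, show Real.pi * (4 * q ^ 2) = (4 * Real.pi) * q ^ 2 by ring,
      Real.mul_rpow (by positivity) (by positivity), ← Real.rpow_natCast q 2,
      ← Real.rpow_mul hq.le, ← Real.rpow_natCast q d]
    congr 2
    · simp
    · simp [mul_div_cancel₀]
  rw [hint] at hsum
  have hq' : 0 < q ^ d := by positivity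
  refine le_of_mul_le_mul_right ?_ hq'
  calc _ = _ := by ring
    _ ≤ _ := hsum
    _ = _ := by ring

/-- For a `2q`-separated set the exponential system is nearly orthogonal with respect to a Gaussian
weight of width at least a multiple of `1 / q`: the Gram matrix is diagonally dominant. -/
lemma exists_gaussian_frame_bounds (d : ℕ) : ∃ b₀ : ℝ, 0 < b₀ ∧ ∀ q : ℝ, 0 < q →
    ∀ X : Finset (Space d), (∀ x ∈ X, ∀ y ∈ X, x ≠ y → 2 * q ≤ dist x y) → ∀ c : X → ℝ,
    ∀ b : ℝ, 0 < b → b ≤ b₀ * q ^ 2 →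
      1 / 2 * (Real.pi / b) ^ ((d : ℝ) / 2) * ∑ x, c x ^ 2 ≤
        ∫ ω, Real.exp (-b * ‖ω‖ ^ 2) * ‖expSum X c ω‖ ^ 2 ∧
      ∫ ω, Real.exp (-b * ‖ω‖ ^ 2) * ‖expSum X c ω‖ ^ 2 ≤
        3 / 2 * (Real.pi / b) ^ ((d : ℝ) / 2) * ∑ x, c x ^ 2 := by
  classical
  obtain ⟨M, hM, hpack⟩ := exists_sum_gaussian_le d
  -- for this constant the off-diagonal row sums are at most `M exp (-2M) ≤ 1/2`
  refine ⟨(2 + 2 * M)⁻¹, by positivity, ?_⟩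
  intro q hq X hX c b hb hbq
  set K : X → X → ℝ := fun x y => Real.exp (-(dist (x : Space d) y ^ 2 / (4 * b))) with hK
  have hKsymm : ∀ x y, K x y = K y x := fun x y => by simp only [hK, dist_comm]
  have hK0 : ∀ x y, 0 ≤ K x y := fun x y => (Real.exp_pos _).le
  have hoff : ∀ x y : X, y ≠ x → K x y ≤ Real.exp (-(2 * M)) *
      Real.exp (-(dist (y : Space d) x ^ 2 / (2 * q ^ 2))) := by
    intro x y hxy
    rw [← Real.exp_add]
    apply Real.exp_le_exp.2
    have hd := hX y y.2 x x.2 (fun h => hxy (Subtype.ext h))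
    have hd2 : 4 * q ^ 2 ≤ dist (y : Space d) x ^ 2 := by nlinarith
    rw [dist_comm (x : Space d) y]
    have h1 : (2 + 2 * M) * b ≤ q ^ 2 := by
      rw [inv_mul_eq_div, le_div_iff₀ (by positivity)] at hbq; linarith
    set D := dist (y : Space d) x ^ 2
    have h2 : D / (2 * q ^ 2) + 2 * M ≤ D / (4 * b) := by
      rw [← sub_nonneg]
      have : D / (4 * b) - (D / (2 * q ^ 2) + 2 * M) =
        (D * (q ^ 2 - 2 * b) - 8 * M * b * q ^ 2) / (4 * b * q ^ 2) := by field_simp; ring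
      rw [this]
      apply div_nonneg _ (by positivity)
      have h3 : 4 * q ^ 2 * (q ^ 2 - 2 * b) ≤ D * (q ^ 2 - 2 * b) := by
        apply mul_le_mul_of_nonneg_right hd2; nlinarith
      nlinarith [mul_le_mul_of_nonneg_left h1 (sq_nonneg q)]
    linarith
  have hrow : ∀ x : X, ∑ y ∈ Finset.univ.erase x, K x y ≤ 1 / 2 := by
    intro x
    calc _ ≤ ∑ y ∈ Finset.univ.erase x, Real.exp (-(2 * M)) *
          Real.exp (-(dist (y : Space d) x ^ 2 / (2 * q ^ 2))) :=
          Finset.sum_le_sum fun y hy => hoff x y (Finset.ne_of_mem_erase hy)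
      _ ≤ ∑ y : X, Real.exp (-(2 * M)) *
          Real.exp (-(dist (y : Space d) x ^ 2 / (2 * q ^ 2))) :=
          Finset.sum_le_sum_of_subset_of_nonneg (Finset.erase_subset _ _)
            fun _ _ _ => by positivity
      _ ≤ Real.exp (-(2 * M)) * M := by
          rw [← Finset.mul_sum]
          gcongr
          rw [Finset.sum_coe_sort X
            (fun y : Space d => Real.exp (-(dist y (x : Space d) ^ 2 / (2 * q ^ 2))))]
          exact hpack q hq X hX x
      _ ≤ 1 / 2 := by
          rw [Real.exp_neg, inv_mul_le_iff₀ (Real.exp_pos _)]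
          linarith [Real.add_one_le_exp (2 * M)]
  set S := ∑ x, c x ^ 2 with hS
  set E := ∑ x, ∑ y ∈ Finset.univ.erase x, c x * c y * K x y with hE
  have hsplit : ∑ x : X, ∑ y : X, c x * c y * K x y = S + E := by
    rw [hS, hE, ← Finset.sum_add_distrib]
    refine Finset.sum_congr rfl fun x _ => ?_
    rw [← Finset.add_sum_erase _ _ (Finset.mem_univ x)]
    simp only [hK, dist_self]
    simp [sq]
  -- Schur's test
  have hEabs : |E| ≤ 1 / 2 * S := by
    have hswap : ∑ x, ∑ y ∈ Finset.univ.erase x, c y ^ 2 * K x y =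
        ∑ x, ∑ y ∈ Finset.univ.erase x, c x ^ 2 * K x y := by
      rw [Finset.sum_comm' (t' := Finset.univ) (s' := fun y => Finset.univ.erase y)]
      · refine Finset.sum_congr rfl fun x _ => Finset.sum_congr rfl fun y _ => ?_
        rw [hKsymm]
      · intro x y; simp [ne_comm]
    calc |E| ≤ ∑ x, ∑ y ∈ Finset.univ.erase x, (c x ^ 2 * K x y + c y ^ 2 * K x y) / 2 := by
          refine (Finset.abs_sum_le_sum_abs _ _).trans (Finset.sum_le_sum fun x _ => ?_)
          refine (Finset.abs_sum_le_sum_abs _ _).trans (Finset.sum_le_sum fun y _ => ?_)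
          rw [abs_mul, abs_of_nonneg (hK0 x y), abs_mul, ← add_mul, mul_div_right_comm]
          refine mul_le_mul_of_nonneg_right ?_ (hK0 x y)
          rw [← sq_abs (c x), ← sq_abs (c y)]
          nlinarith [sq_nonneg (|c x| - |c y|)]
      _ = ∑ x, ∑ y ∈ Finset.univ.erase x, c x ^ 2 * K x y := by
          simp_rw [← Finset.sum_div, Finset.sum_add_distrib]
          rw [hswap]; ring
      _ ≤ ∑ x, c x ^ 2 * (1 / 2) := by
          refine Finset.sum_le_sum fun x _ => ?_
          rw [← Finset.mul_sum]
          exact mul_le_mul_of_nonneg_left (hrow x) (sq_nonneg _)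
      _ = 1 / 2 * S := by rw [← Finset.sum_mul]; ring
  rw [integral_gaussian_mul_norm_expSum_sq X c hb, hsplit]
  have hp : 0 ≤ (Real.pi / b) ^ ((d : ℝ) / 2) := by positivity
  have := abs_le.1 hEabs
  constructor <;> nlinarith

/-! ### The kernel quadratic form is controlled by low frequencies -/

/-- A bandwidth of at least a dimensional constant times `1 / q` makes the exponential system of a
`2q`-separated set stable on the ball of that radius. -/
lemma exists_expSum_lower_bound (d : ℕ) : ∃ κ₀ : ℝ, 0 < κ₀ ∧ ∀ κ : ℝ, κ₀ ≤ κ →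
    ∃ a : ℝ, 0 < a ∧ ∀ q : ℝ, 0 < q →
    ∀ X : Finset (Space d), (∀ x ∈ X, ∀ y ∈ X, x ≠ y → 2 * q ≤ dist x y) → ∀ c : X → ℝ,
      a * (κ / q) ^ (d : ℝ) * ∑ x, c x ^ 2 ≤
        ∫ ω in Metric.closedBall 0 (κ / q), ‖expSum X c ω‖ ^ 2 ∧
      ∀ b : ℝ, 0 < b → b ≤ ((κ / q) ^ 2)⁻¹ →
        ∫ ω, Real.exp (-b * ‖ω‖ ^ 2) * ‖expSum X c ω‖ ^ 2 ≤
          3 / 2 * (Real.pi / b) ^ ((d : ℝ) / 2) * ∑ x, c x ^ 2 := by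
  obtain ⟨b₀, hb₀, hG⟩ := exists_gaussian_frame_bounds d
  set A : ℝ := 6 * (2 : ℝ) ^ ((d : ℝ) / 2) with hA
  have hA0 : 0 < A := by positivity
  -- `b₀ κ₀² ≥ 1` and `exp (-b₀ κ₀² / 2)` beats the factor `A`
  refine ⟨Real.sqrt ((1 + 2 * A) / b₀), by positivity, ?_⟩
  intro κ hκ
  have hκ0 : 0 < κ := lt_of_lt_of_le (by positivity) hκ
  have hbκ : 1 + 2 * A ≤ b₀ * κ ^ 2 := by
    have := Real.sqrt_le_left hκ0.le |>.1 hκ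
    rw [div_le_iff₀ hb₀] at this
    linarith
  refine ⟨1 / 4 * (Real.pi / (b₀ * κ ^ 2)) ^ ((d : ℝ) / 2), by positivity, ?_⟩
  intro q hq X hX c
  set σ := κ / q with hσ
  have hσ0 : 0 < σ := by positivity
  have hqσ : q ^ 2 = κ ^ 2 * (σ ^ 2)⁻¹ := by rw [hσ]; field_simp
  set S := ∑ x, c x ^ 2 with hS
  have hS0 : 0 ≤ S := Finset.sum_nonneg fun _ _ => sq_nonneg _
  refine ⟨?_, fun b hb hbσ => (hG q hq X hX c b hb ?_).2⟩
  swap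
  · refine hbσ.trans ?_
    rw [hqσ, ← mul_assoc]
    refine le_mul_of_one_le_left (by positivity) (by linarith)
  -- the Gaussian of parameter `b` is split at radius `σ`; its tail is dominated by the Gaussian of
  -- parameter `b / 2`
  set b := b₀ * q ^ 2 with hb
  have hb0 : 0 < b := by positivity
  have hbσ : b * σ ^ 2 = b₀ * κ ^ 2 := by rw [hb, hσ]; field_simp
  have h1 := (hG q hq X hX c b hb0 le_rfl).1
  have h2 := (hG q hq X hX c (b / 2) (by positivity) (by linarith)).2
  have hi := fun b (hb : 0 < b) =>
    integrable_mul_norm_expSum_sq X c (integrable_exp_neg_mul_norm_sq (d := d) (b := b) hb)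
  set B := Metric.closedBall (0 : Space d) σ with hB
  have hBm : MeasurableSet B := Metric.isClosed_closedBall.measurableSet
  have h3 : ∫ ω in B, Real.exp (-b * ‖ω‖ ^ 2) * ‖expSum X c ω‖ ^ 2 ≤
      ∫ ω in B, ‖expSum X c ω‖ ^ 2 := by
    refine setIntegral_mono_on (hi b hb0).integrableOn ?_ hBm fun ω _ => ?_
    · exact ContinuousOn.integrableOn_compact (isCompact_closedBall _ _) (by fun_prop)
    · refine mul_le_of_le_one_left (by positivity) (Real.exp_le_one_iff.2 ?_)
      nlinarith [sq_nonneg ‖ω‖]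
  have h4 : ∫ ω in Bᶜ, Real.exp (-b * ‖ω‖ ^ 2) * ‖expSum X c ω‖ ^ 2 ≤
      Real.exp (-(b₀ * κ ^ 2 / 2)) *
        (3 / 2 * (Real.pi / (b / 2)) ^ ((d : ℝ) / 2) * S) := by
    calc _ ≤ ∫ ω in Bᶜ, Real.exp (-(b₀ * κ ^ 2 / 2)) *
          (Real.exp (-(b / 2) * ‖ω‖ ^ 2) * ‖expSum X c ω‖ ^ 2) := by
          refine setIntegral_mono_on (hi b hb0).integrableOn
            ((hi _ (by positivity)).const_mul _).integrableOn hBm.compl fun ω hω => ?_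
          rw [← mul_assoc, ← Real.exp_add]
          refine mul_le_mul_of_nonneg_right (Real.exp_le_exp.2 ?_) (by positivity)
          have hω' : σ < ‖ω‖ := by simpa [hB] using hω
          have : σ ^ 2 ≤ ‖ω‖ ^ 2 := by gcongr
          rw [← hbσ]
          nlinarith
      _ ≤ ∫ ω, Real.exp (-(b₀ * κ ^ 2 / 2)) *
          (Real.exp (-(b / 2) * ‖ω‖ ^ 2) * ‖expSum X c ω‖ ^ 2) :=
          setIntegral_le_integral ((hi _ (by positivity)).const_mul _)
            (.of_forall fun ω => by positivity)
      _ ≤ _ := by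
          rw [integral_const_mul]
          gcongr
  rw [← integral_add_compl hBm (hi b hb0)] at h1
  set p := (Real.pi / b) ^ ((d : ℝ) / 2) with hp
  have hp0 : 0 ≤ p := by positivity
  have hp2 : (Real.pi / (b / 2)) ^ ((d : ℝ) / 2) = 2 ^ ((d : ℝ) / 2) * p := by
    rw [hp, ← Real.mul_rpow (by positivity) (by positivity)]
    congr 1; field_simp
  have h5 : Real.exp (-(b₀ * κ ^ 2 / 2)) * A ≤ 1 := by
    rw [Real.exp_neg, inv_mul_le_iff₀ (Real.exp_pos _)]
    linarith [Real.add_one_le_exp (b₀ * κ ^ 2 / 2)]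
  have h6 : Real.exp (-(b₀ * κ ^ 2 / 2)) * (3 / 2 * (Real.pi / (b / 2)) ^ ((d : ℝ) / 2) * S) ≤
      1 / 4 * (p * S) := by
    rw [hp2]
    calc _ = Real.exp (-(b₀ * κ ^ 2 / 2)) * A * (1 / 4 * (p * S)) := by rw [hA]; ring
      _ ≤ _ := mul_le_of_le_one_left (by positivity) h5
  have h7 : 1 / 4 * (Real.pi / (b₀ * κ ^ 2)) ^ ((d : ℝ) / 2) * σ ^ (d : ℝ) = 1 / 4 * p := by
    have : σ ^ (d : ℝ) = (σ ^ 2) ^ ((d : ℝ) / 2) := by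
      rw [← Real.rpow_natCast σ 2, ← Real.rpow_mul hσ0.le]
      simp [mul_div_cancel₀]
    rw [this, mul_assoc, ← Real.mul_rpow (by positivity) (by positivity), hp, ← hbσ]
    congr 2
    field_simp
  rw [h7]
  nlinarith

lemma lintegral_rpow_sub_one_Ioc {p T : ℝ} (hp : 0 < p) (hT : 0 ≤ T) :
    ∫⁻ b in Set.Ioc 0 T, ENNReal.ofReal (b ^ (p - 1)) = ENNReal.ofReal (T ^ p / p) := by
  have hi : IntervalIntegrable (fun b : ℝ => b ^ (p - 1)) volume 0 T :=
    intervalIntegral.intervalIntegrable_rpow' (by linarith)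
  rw [intervalIntegrable_iff_integrableOn_Ioc_of_le hT] at hi
  rw [← ofReal_integral_eq_lintegral_ofReal hi, ← intervalIntegral.integral_of_le hT,
    integral_rpow (Or.inl (by linarith))]
  · simp [Real.zero_rpow hp.ne']
  · refine (ae_restrict_iff' measurableSet_Ioc).2 (.of_forall fun b hb => ?_)
    exact Real.rpow_nonneg hb.1.le _

/-- A negative power is dominated by a mixture of exponentials, by the Gamma integral truncated to
small parameters. -/
lemma ofReal_rpow_neg_le_lintegral {m r T : ℝ} (hm : 0 < m) (hr : 0 < r) (hrT : r⁻¹ ≤ T) :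
    ENNReal.ofReal (r ^ (-m)) ≤ ENNReal.ofReal (Real.exp 1 * m) *
      ∫⁻ b in Set.Ioc 0 T, ENNReal.ofReal (b ^ (m - 1)) * ENNReal.ofReal (Real.exp (-b * r)) := by
  have h : ENNReal.ofReal ((r⁻¹) ^ m / m) * ENNReal.ofReal (Real.exp (-1)) ≤
      ∫⁻ b in Set.Ioc 0 T,
        ENNReal.ofReal (b ^ (m - 1)) * ENNReal.ofReal (Real.exp (-b * r)) := by
    rw [← lintegral_rpow_sub_one_Ioc hm (by positivity),
      ← lintegral_mul_const' _ _ ENNReal.ofReal_ne_top]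
    refine le_trans ?_ (lintegral_mono_set (Set.Ioc_subset_Ioc_right hrT))
    refine setLIntegral_mono' measurableSet_Ioc fun b hb => ?_
    gcongr
    have := mul_le_mul_of_nonneg_right hb.2 hr.le
    rw [inv_mul_cancel₀ hr.ne'] at this
    linarith
  refine le_trans (le_of_eq ?_) (mul_le_mul_right h _)
  rw [← ENNReal.ofReal_mul (by positivity), ← ENNReal.ofReal_mul (by positivity)]
  congr 1
  rw [Real.rpow_neg hr.le, Real.inv_rpow hr.le, Real.exp_neg]
  field_simp

/-- The high-frequency part of the kernel quadratic form, from an upper frame bound for Gaussian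
weights. -/
lemma lintegral_tail_norm_expSum_sq_le {d : ℕ} {X : Finset (Space d)} {c : X → ℝ} {m σ S : ℝ}
    (hm : (d : ℝ) / 2 < m) (hσ : 0 < σ) (_hS : 0 ≤ S)
    (hG : ∀ b : ℝ, 0 < b → b ≤ (σ ^ 2)⁻¹ →
      ∫ ω, Real.exp (-b * ‖ω‖ ^ 2) * ‖expSum X c ω‖ ^ 2 ≤
        3 / 2 * (Real.pi / b) ^ ((d : ℝ) / 2) * S) :
    ∫⁻ ω in (Metric.closedBall 0 σ)ᶜ,
        ENNReal.ofReal ((1 + ‖ω‖ ^ 2) ^ (-m) * ‖expSum X c ω‖ ^ 2) ≤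
      ENNReal.ofReal (Real.exp 1 * m * (3 / 2 * Real.pi ^ ((d : ℝ) / 2) * S *
        (σ ^ ((d : ℝ) - 2 * m) / (m - (d : ℝ) / 2)))) := by
  have hd : (0 : ℝ) ≤ d := Nat.cast_nonneg d
  have hm0 : 0 < m := by linarith
  set T := (σ ^ 2)⁻¹ with hT
  have hT0 : 0 < T := by positivity
  have hBm : MeasurableSet (Metric.closedBall (0 : Space d) σ)ᶜ :=
    Metric.isClosed_closedBall.measurableSet.compl
  calc _ ≤ ∫⁻ ω in (Metric.closedBall (0 : Space d) σ)ᶜ, ENNReal.ofReal (Real.exp 1 * m) *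
        ∫⁻ b in Set.Ioc 0 T, ENNReal.ofReal (b ^ (m - 1)) *
          ENNReal.ofReal (Real.exp (-b * ‖ω‖ ^ 2) * ‖expSum X c ω‖ ^ 2) := by
        refine setLIntegral_mono' hBm fun ω hω => ?_
        have hω' : σ < ‖ω‖ := by simpa using hω
        have hω0 : 0 < ‖ω‖ := hσ.trans hω'
        rw [ENNReal.ofReal_mul (by positivity)]
        simp_rw [ENNReal.ofReal_mul (Real.exp_nonneg (-_ * ‖ω‖ ^ 2)), ← mul_assoc]
        rw [lintegral_mul_const' _ _ ENNReal.ofReal_ne_top, ← mul_assoc]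
        gcongr
        refine le_trans ?_ (ofReal_rpow_neg_le_lintegral hm0 (r := ‖ω‖ ^ 2) (by positivity) ?_)
        · refine ENNReal.ofReal_le_ofReal ?_
          exact Real.rpow_le_rpow_of_nonpos (by positivity) (by linarith) (by linarith)
        · rw [hT]; gcongr
    _ ≤ ∫⁻ ω : Space d, ENNReal.ofReal (Real.exp 1 * m) *
        ∫⁻ b in Set.Ioc 0 T, ENNReal.ofReal (b ^ (m - 1)) *
          ENNReal.ofReal (Real.exp (-b * ‖ω‖ ^ 2) * ‖expSum X c ω‖ ^ 2) :=
        setLIntegral_le_lintegral _ _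
    _ = ENNReal.ofReal (Real.exp 1 * m) * ∫⁻ b in Set.Ioc 0 T, ENNReal.ofReal (b ^ (m - 1)) *
          ∫⁻ ω : Space d, ENNReal.ofReal (Real.exp (-b * ‖ω‖ ^ 2) * ‖expSum X c ω‖ ^ 2) := by
        rw [lintegral_const_mul' _ _ ENNReal.ofReal_ne_top, lintegral_lintegral_swap]
        · simp_rw [lintegral_const_mul' _ _ ENNReal.ofReal_ne_top]
        · refine Measurable.aemeasurable ?_
          have : Measurable fun p : Space d × ℝ => expSum X c p.1 :=
            (continuous_expSum X c).measurable.comp measurable_fst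
          unfold Function.uncurry
          fun_prop
    _ ≤ ENNReal.ofReal (Real.exp 1 * m) * ∫⁻ b in Set.Ioc 0 T,
          ENNReal.ofReal (b ^ (m - (d : ℝ) / 2 - 1)) *
            ENNReal.ofReal (3 / 2 * Real.pi ^ ((d : ℝ) / 2) * S) := by
        gcongr ENNReal.ofReal (Real.exp 1 * m) * ?_
        refine setLIntegral_mono' measurableSet_Ioc fun b hb => ?_
        have hb0 : 0 < b := hb.1
        rw [← ofReal_integral_eq_lintegral_ofReal
          (integrable_mul_norm_expSum_sq X c (integrable_exp_neg_mul_norm_sq hb0))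
          (.of_forall fun ω => by positivity), ← ENNReal.ofReal_mul (by positivity),
          ← ENNReal.ofReal_mul (by positivity)]
        refine ENNReal.ofReal_le_ofReal ?_
        refine (mul_le_mul_of_nonneg_left (hG b hb0 hb.2) (by positivity)).trans (le_of_eq ?_)
        rw [Real.div_rpow Real.pi_pos.le hb0.le,
          show m - (d : ℝ) / 2 - 1 = (m - 1) - (d : ℝ) / 2 by ring, Real.rpow_sub hb0 (m - 1)]
        ring
    _ = _ := by
        rw [lintegral_mul_const' _ _ ENNReal.ofReal_ne_top,
          lintegral_rpow_sub_one_Ioc (by linarith) hT0.le,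
          ← ENNReal.ofReal_mul (by have : 0 < m - (d : ℝ) / 2 := by linarith
                                   positivity),
          ← ENNReal.ofReal_mul (by positivity)]
        congr 1
        have : T ^ (m - (d : ℝ) / 2) = σ ^ ((d : ℝ) - 2 * m) := by
          rw [hT, ← Real.rpow_natCast σ 2, ← Real.rpow_neg hσ.le, ← Real.rpow_mul hσ.le]
          congr 1; push_cast; ring
        rw [this]; ring

lemma integrable_one_add_sq_rpow_neg {d : ℕ} {m : ℝ} (hm : (d : ℝ) / 2 < m) :
    Integrable (fun ω : Space d => (1 + ‖ω‖ ^ 2) ^ (-m)) := by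
  have h := integrable_rpow_neg_one_add_norm_sq (E := Space d) (μ := volume) (r := 2 * m)
    (by rw [finrank_euclideanSpace_fin]; linarith)
  convert! h using 3
  ring

/-- The kernel quadratic form is controlled by its low-frequency part: uniformly in the smoothness
`m` and in `2q`-separated sets, provided that the bandwidth `κ / q` is bounded below. -/
theorem exists_lowpass_bound (d : ℕ) : ∃ κ₀ : ℝ, 0 < κ₀ ∧ ∀ κ : ℝ, κ₀ ≤ κ →
    ∀ m₁ m₂ : ℝ, (d : ℝ) / 2 < m₁ → ∀ σ₀ : ℝ, 0 < σ₀ → ∃ C : ℝ, 0 < C ∧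
    ∀ q : ℝ, 0 < q → ∀ X : Finset (Space d),
      (∀ x ∈ X, ∀ y ∈ X, x ≠ y → 2 * q ≤ dist x y) → ∀ c : X → ℝ,
      (c ≠ 0 → ∀ t : ℝ, 0 < ∫ ω in Metric.closedBall 0 (κ / q),
          (1 + ‖ω‖ ^ 2) ^ t * ‖expSum X c ω‖ ^ 2) ∧
      ∀ m ∈ Set.Icc m₁ m₂, σ₀ ≤ κ / q →
      ∫ ω, (1 + ‖ω‖ ^ 2) ^ (-m) * ‖expSum X c ω‖ ^ 2 ≤
        C * ∫ ω in Metric.closedBall 0 (κ / q), (1 + ‖ω‖ ^ 2) ^ (-m) * ‖expSum X c ω‖ ^ 2 := by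
  obtain ⟨κ₀, hκ₀, H⟩ := exists_expSum_lower_bound d
  refine ⟨κ₀, hκ₀, fun κ hκ m₁ m₂ hm₁ σ₀ hσ₀ => ?_⟩
  have hκ0 : 0 < κ := hκ₀.trans_le hκ
  obtain ⟨a, ha, H⟩ := H κ hκ
  have hd : (0 : ℝ) ≤ d := Nat.cast_nonneg d
  have hm₁' : 0 < m₁ - (d : ℝ) / 2 := by linarith
  set D : ℝ := Real.exp 1 * |m₂| * (3 / 2 * Real.pi ^ ((d : ℝ) / 2) / (m₁ - (d : ℝ) / 2)) with hD
  set E : ℝ := (1 + (σ₀ ^ 2)⁻¹) ^ |m₂| with hE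
  have hD0 : 0 ≤ D := by positivity
  refine ⟨1 + D * E / a, by positivity, fun q hq X hX c => ?_⟩
  obtain ⟨hlow, hup⟩ := H q hq X hX c
  set σ := κ / q with hσ
  have hσ0 : 0 < σ := by positivity
  set S := ∑ x, c x ^ 2 with hS
  have hS0 : 0 ≤ S := Finset.sum_nonneg fun _ _ => sq_nonneg _
  set B := Metric.closedBall (0 : Space d) σ with hB
  have hBm : MeasurableSet B := Metric.isClosed_closedBall.measurableSet
  have hc1 : ∀ t : ℝ, Continuous fun ω : Space d => (1 + ‖ω‖ ^ 2) ^ t := fun t =>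
    Continuous.rpow_const (by fun_prop) fun ω => Or.inl (by positivity)
  have hc2 : ∀ t : ℝ, IntegrableOn
      (fun ω : Space d => (1 + ‖ω‖ ^ 2) ^ t * ‖expSum X c ω‖ ^ 2) B := fun t =>
    ContinuousOn.integrableOn_compact (isCompact_closedBall _ _)
      ((hc1 t).mul (by fun_prop)).continuousOn
  -- on the ball the weight is at least its smaller extreme value
  have hlow' : ∀ t k : ℝ, 0 ≤ k → (∀ r : ℝ, 1 ≤ r → r ≤ 1 + σ ^ 2 → k ≤ r ^ t) →
      k * (a * σ ^ (d : ℝ) * S) ≤ ∫ ω in B, (1 + ‖ω‖ ^ 2) ^ t * ‖expSum X c ω‖ ^ 2 := by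
    intro t k hk hkt
    refine (mul_le_mul_of_nonneg_left hlow hk).trans ?_
    rw [← integral_const_mul]
    refine setIntegral_mono_on ?_ (hc2 t) hBm fun ω hω => ?_
    · exact ContinuousOn.integrableOn_compact (isCompact_closedBall _ _) (by fun_prop)
    · have hω' : ‖ω‖ ≤ σ := by simpa [hB] using hω
      gcongr
      exact hkt _ (by nlinarith [sq_nonneg ‖ω‖]) (by gcongr)
  constructor
  · intro hc t
    have hSpos : 0 < S := by
      obtain ⟨x, hx⟩ := Function.ne_iff.1 hc
      refine Finset.sum_pos' (fun _ _ => sq_nonneg _) ⟨x, Finset.mem_univ _, ?_⟩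
      have hx' : c x ≠ 0 := hx
      positivity
    refine lt_of_lt_of_le ?_ (hlow' t ((1 + σ ^ 2) ^ (-|t|)) (by positivity) fun r hr hr' => ?_)
    · positivity
    · calc (1 + σ ^ 2) ^ (-|t|) ≤ r ^ (-|t|) :=
            Real.rpow_le_rpow_of_nonpos (by linarith) hr' (by simp)
        _ ≤ r ^ t := Real.rpow_le_rpow_of_exponent_le hr (neg_abs_le t)
  · intro m hm hσσ
    have hmd : (d : ℝ) / 2 < m := hm₁.trans_le hm.1
    have hm0 : 0 < m := by linarith
    have htail := lintegral_tail_norm_expSum_sq_le hmd hσ0 hS0 hup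
    have hint := integrable_mul_norm_expSum_sq X c (integrable_one_add_sq_rpow_neg hmd)
    have hmd' : 0 < m - (d : ℝ) / 2 := by linarith
    rw [← ofReal_integral_eq_lintegral_ofReal hint.integrableOn
      (.of_forall fun ω => by positivity), ENNReal.ofReal_le_ofReal_iff (by positivity)] at htail
    have hlow2 := hlow' (-m) ((1 + σ ^ 2) ^ (-m)) (by positivity) fun r hr hr' =>
      Real.rpow_le_rpow_of_nonpos (by linarith) hr' (by linarith)
    have hm2 : m ≤ |m₂| := hm.2.trans (le_abs_self _)
    have h1 : Real.exp 1 * m * (3 / 2 * Real.pi ^ ((d : ℝ) / 2) * S *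
        (σ ^ ((d : ℝ) - 2 * m) / (m - (d : ℝ) / 2))) ≤ D * (S * σ ^ ((d : ℝ) - 2 * m)) := by
      have e : Real.exp 1 * m * (3 / 2 * Real.pi ^ ((d : ℝ) / 2) * S *
        (σ ^ ((d : ℝ) - 2 * m) / (m - (d : ℝ) / 2))) =
        Real.exp 1 * m * (3 / 2 * Real.pi ^ ((d : ℝ) / 2) / (m - (d : ℝ) / 2)) *
          (S * σ ^ ((d : ℝ) - 2 * m)) := by ring
      rw [e, hD]
      gcongr
      exact hm.1
    have h2 : σ ^ ((d : ℝ) - 2 * m) ≤ E * ((1 + σ ^ 2) ^ (-m) * σ ^ (d : ℝ)) := by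
      have e1 : σ ^ ((d : ℝ) - 2 * m) = (σ ^ 2) ^ (-m) * σ ^ (d : ℝ) := by
        rw [← Real.rpow_natCast σ 2, ← Real.rpow_mul hσ0.le, ← Real.rpow_add hσ0]
        congr 1; push_cast; ring
      have e2 : (1 + σ ^ 2) ^ (-m) = (1 + (σ ^ 2)⁻¹) ^ (-m) * (σ ^ 2) ^ (-m) := by
        rw [← Real.mul_rpow (by positivity) (by positivity)]
        congr 1; field_simp; ring
      have e3 : 1 ≤ E * (1 + (σ ^ 2)⁻¹) ^ (-m) := by
        rw [Real.rpow_neg (by positivity), ← div_eq_mul_inv, one_le_div (by positivity), hE]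
        calc (1 + (σ ^ 2)⁻¹) ^ m ≤ (1 + (σ₀ ^ 2)⁻¹) ^ m := by gcongr
          _ ≤ _ := Real.rpow_le_rpow_of_exponent_le
              (le_add_of_nonneg_right (by positivity)) hm2
      rw [e1, e2]
      calc _ ≤ (E * (1 + (σ ^ 2)⁻¹) ^ (-m)) * ((σ ^ 2) ^ (-m) * σ ^ (d : ℝ)) :=
            le_mul_of_one_le_left (by positivity) e3
        _ = _ := by ring
    rw [← integral_add_compl hBm hint]
    set J := ∫ ω in B, (1 + ‖ω‖ ^ 2) ^ (-m) * ‖expSum X c ω‖ ^ 2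
    have h3 : D * (S * σ ^ ((d : ℝ) - 2 * m)) ≤ D * E / a * J := by
      calc _ ≤ D * (S * (E * ((1 + σ ^ 2) ^ (-m) * σ ^ (d : ℝ)))) := by gcongr
        _ = D * E / a * ((1 + σ ^ 2) ^ (-m) * (a * σ ^ (d : ℝ) * S)) := by field_simp
        _ ≤ _ := by gcongr
    linarith [htail.trans (h1.trans h3)]

/-! ### The Fourier transform of band-limited functions -/

open FourierTransform in
lemma integral_fourierInv_smul_eq_flip {V : Type*} [NormedAddCommGroup V] [InnerProductSpace ℝ V]
    [FiniteDimensional ℝ V] [MeasurableSpace V] [BorelSpace V] {f g : V → ℂ}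
    (hf : Integrable f) (hg : Integrable g) :
    ∫ ξ, 𝓕⁻ f ξ • g ξ = ∫ x, f x • 𝓕⁻ g x := by
  have h := VectorFourier.integral_fourierIntegral_smul_eq_flip (e := Real.fourierChar)
    (L := -innerₗ V) (μ := volume) (ν := volume) Real.continuous_fourierChar
    (continuous_inner (𝕜 := ℝ) (E := V)).fun_neg hf hg
  have hflip : (-innerₗ V).flip = -innerₗ V := by
    ext x y; simp [real_inner_comm]
  rw [hflip] at h
  exact h

open FourierTransform ContDiff in
/-- The inverse Fourier transform of an integrable `L²` function is given by the Fourier integral. -/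
lemma Lp_fourierInv_ae_eq {d : ℕ} (h : L2 d) (hh : Integrable (h : Space d → ℂ)) :
    ((𝓕⁻ h : L2 d) : Space d → ℂ) =ᵐ[volume] 𝓕⁻ (h : Space d → ℂ) := by
  have hcont : Continuous (𝓕⁻ (h : Space d → ℂ)) := by
    have hm : MemLp (h : Space d → ℂ) 1 volume := memLp_one_iff_integrable.2 hh
    rw [← Real.Lp.fourierTransformInv_toLp hm]
    exact (Real.Lp.fourierTransformInv hm.toLp).continuous
  refine ae_eq_of_integral_contDiff_smul_eq
    ((Lp.memLp _).locallyIntegrable (by norm_num)) hcont.locallyIntegrable fun g hg hgc => ?_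
  have hg₁ : HasCompactSupport (Complex.ofRealCLM ∘ g) := hgc.comp_left rfl
  have hg₂ : ContDiff ℝ ∞ (Complex.ofRealCLM ∘ g) := Complex.ofRealCLM.contDiff.comp hg
  set φ := hg₁.toSchwartzMap hg₂ with hφ
  have hφ' : ∀ x, φ x = (g x : ℂ) := fun x => rfl
  have key := congrArg (fun T => T φ) (Lp.fourierInv_toTemperedDistribution_eq h)
  simp only [TemperedDistribution.fourierInv_apply, Lp.toTemperedDistribution_apply] at key
  rw [SchwartzMap.fourierInv_coe, integral_fourierInv_smul_eq_flip φ.integrable hh] at key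
  simp only [hφ'] at key
  simpa using key.symm

section Scaling
variable {d : ℕ}

lemma quasiMeasurePreserving_smul_real {r : ℝ} (hr : r ≠ 0) :
    Measure.QuasiMeasurePreserving (fun ω : Space d => r • ω) volume volume := by
  refine ⟨by fun_prop, ?_⟩
  rw [Measure.map_addHaar_smul _ hr]
  exact Measure.smul_absolutelyContinuous

lemma memLp_comp_smul {r : ℝ} (hr : r ≠ 0) {g : Space d → ℂ} (hg : MemLp g 2 volume) :
    MemLp (fun ω => g (r • ω)) 2 volume := by
  have h : MemLp g 2 (Measure.map (fun ω : Space d => r • ω) volume) := by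
    rw [Measure.map_addHaar_smul _ hr]
    exact hg.smul_measure ENNReal.ofReal_ne_top
  exact (memLp_map_measure_iff h.1 (by fun_prop)).1 h

end Scaling

section Fhat
variable {d : ℕ}

/-- The normalizing constant `(2π)^(-d/2)` of the unitary Fourier transform. -/
noncomputable def fourierConst (d : ℕ) : ℝ := (2 * Real.pi) ^ (-(d : ℝ) / 2)

lemma fourierConst_pos : 0 < fourierConst d := by unfold fourierConst; positivity

lemma fourierConst_mul_self_mul : fourierConst d * fourierConst d * (2 * Real.pi) ^ d = 1 := by
  unfold fourierConst
  rw [← Real.rpow_add (by positivity), ← Real.rpow_natCast, ← Real.rpow_add (by positivity)]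
  ring_nf
  simp

lemma memLp_fhat (f : L2 d) : MemLp (fhat f) 2 volume :=
  (memLp_comp_smul (by positivity) (Lp.memLp _)).const_mul _

lemma fhat_sub_ae (f g : L2 d) : fhat (f - g) =ᵐ[volume] fun ω => fhat f ω - fhat g ω := by
  have h := (quasiMeasurePreserving_smul_real (d := d) (r := (2 * Real.pi)⁻¹)
    (by positivity)).ae (Lp.coeFn_sub (Lp.fourierTransformₗᵢ (Space d) ℂ f)
      (Lp.fourierTransformₗᵢ (Space d) ℂ g))
  filter_upwards [h] with ω hω
  simp only [fhat, map_sub]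
  rw [hω, Pi.sub_apply]
  ring

lemma eq_zero_of_fhat_ae_eq_zero {f : L2 d} (hf : fhat f =ᵐ[volume] 0) : f = 0 := by
  have h := (quasiMeasurePreserving_smul_real (d := d) (r := 2 * Real.pi)
    (by positivity)).ae hf
  have h0 : Lp.fourierTransformₗᵢ (Space d) ℂ f = 0 := by
    rw [Lp.eq_zero_iff_ae_eq_zero]
    filter_upwards [h] with ω hω
    have hK : (((2 * Real.pi) ^ (-(d : ℝ) / 2) : ℝ) : ℂ) ≠ 0 :=
      Complex.ofReal_ne_zero.2 (fourierConst_pos (d := d)).ne'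
    rw [fhat, smul_smul, inv_mul_cancel₀ (by positivity), one_smul] at hω
    simpa [hK] using hω
  simpa using h0

lemma exists_fhat_ae_eq {φ : Space d → ℂ} (hφ : MemLp φ 2 volume) :
    ∃ f : L2 d, fhat f =ᵐ[volume] φ := by
  have h1 := (memLp_comp_smul (r := 2 * Real.pi) (by positivity) hφ).const_mul
    (((fourierConst d)⁻¹ : ℝ) : ℂ)
  refine ⟨(Lp.fourierTransformₗᵢ (Space d) ℂ).symm h1.toLp, ?_⟩
  have h2 := (quasiMeasurePreserving_smul_real (d := d) (r := (2 * Real.pi)⁻¹)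
    (by positivity)).ae h1.coeFn_toLp
  filter_upwards [h2] with ω hω
  have hK : ((fourierConst d : ℝ) : ℂ) ≠ 0 :=
    Complex.ofReal_ne_zero.2 (fourierConst_pos (d := d)).ne'
  rw [fhat, LinearIsometryEquiv.apply_symm_apply, hω, smul_smul, mul_inv_cancel₀ (by positivity),
    one_smul, Complex.ofReal_inv]
  exact mul_inv_cancel_left₀ hK _

variable {σ : ℝ}

lemma integrable_fhat {f : L2 d} (hf : f ∈ bandLimited d σ) : Integrable (fhat f) := by
  have h : IntegrableOn (fhat f) (Metric.closedBall 0 σ) := by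
    have : IsFiniteMeasure (volume.restrict (Metric.closedBall (0 : Space d) σ)) :=
      ⟨by simpa using measure_closedBall_lt_top⟩
    exact ((memLp_fhat f).restrict _).integrable (by norm_num)
  refine h.integrable_of_ae_notMem_eq_zero ?_
  filter_upwards [hf] with ω hω hn
  exact hω (by simpa using hn)

lemma integrable_mul_norm_fhat_sq {f : L2 d} (hf : f ∈ bandLimited d σ) {w : Space d → ℝ}
    (hw : Continuous w) : Integrable fun ω => w ω * ‖fhat f ω‖ ^ 2 := by
  have h2 : Integrable fun ω => ‖fhat f ω‖ ^ 2 :=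
    (memLp_two_iff_integrable_sq_norm (memLp_fhat f).1).1 (memLp_fhat f)
  have h : IntegrableOn (fun ω => w ω * ‖fhat f ω‖ ^ 2) (Metric.closedBall 0 σ) :=
    h2.integrableOn.continuousOn_mul hw.continuousOn (isCompact_closedBall _ _)
  refine h.integrable_of_ae_notMem_eq_zero ?_
  filter_upwards [hf] with ω hω hn
  rw [hω (by simpa using hn)]
  simp

lemma continuous_one_add_sq_rpow (t : ℝ) : Continuous fun ω : Space d => (1 + ‖ω‖ ^ 2) ^ t :=
  Continuous.rpow_const (by fun_prop) fun ω => Or.inl (by positivity)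

lemma integrable_sobolevDensity {f : L2 d} (hf : f ∈ bandLimited d σ) (t : ℝ) :
    Integrable (sobolevDensity t f) :=
  integrable_mul_norm_fhat_sq hf (continuous_one_add_sq_rpow t)

lemma sobolevDensity_nonneg (t : ℝ) (f : L2 d) (ω : Space d) : 0 ≤ sobolevDensity t f ω := by
  unfold sobolevDensity; positivity

lemma sobolevNorm_sq (t : ℝ) (f : L2 d) :
    sobolevNorm t f ^ 2 = ∫ ω, sobolevDensity t f ω :=
  Real.sq_sqrt (integral_nonneg fun ω => sobolevDensity_nonneg t f ω)

lemma eq_zero_of_sobolevNorm_eq_zero {f : L2 d} (hf : f ∈ bandLimited d σ) {t : ℝ}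
    (h : sobolevNorm t f = 0) : f = 0 := by
  have h2 := sobolevNorm_sq t f
  rw [h, zero_pow two_ne_zero, eq_comm, integral_eq_zero_iff_of_nonneg
    (fun ω => sobolevDensity_nonneg t f ω) (integrable_sobolevDensity hf t)] at h2
  refine eq_zero_of_fhat_ae_eq_zero ?_
  filter_upwards [h2] with ω hω
  have hw : (1 + ‖ω‖ ^ 2) ^ t ≠ 0 := by positivity
  simpa [sobolevDensity, hw] using hω

lemma sub_mem_bandLimited {f g : L2 d} (hf : f ∈ bandLimited d σ) (hg : g ∈ bandLimited d σ) :
    f - g ∈ bandLimited d σ := by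
  have : ∀ᵐ ω : Space d, σ < ‖ω‖ → fhat (f - g) ω = 0 := by
    filter_upwards [hf, hg, fhat_sub_ae f g] with ω h1 h2 h3 h
    rw [h3, h1 h, h2 h, sub_zero]
  exact this

lemma continuous_integral_mul_exp_I {φ : Space d → ℂ} (hφ : Integrable φ) :
    Continuous fun x : Space d =>
      ∫ ω, φ ω * Complex.exp (Complex.I * (inner ℝ x ω : ℝ)) := by
  refine continuous_of_dominated (bound := fun ω => ‖φ ω‖)
    (fun x => hφ.1.mul (by fun_prop)) (fun x => .of_forall fun ω => ?_) hφ.norm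
    (.of_forall fun ω => by fun_prop)
  rw [norm_mul, mul_comm Complex.I, Complex.norm_exp_ofReal_mul_I, mul_one]

open FourierTransform in
/-- Fourier inversion for band-limited functions. -/
lemma ae_eq_integral_fhat {f : L2 d} (hf : f ∈ bandLimited d σ) :
    (f : Space d → ℂ) =ᵐ[volume] fun x => (fourierConst d : ℂ) *
      ∫ ω, fhat f ω * Complex.exp (Complex.I * (inner ℝ x ω : ℝ)) := by
  set h : L2 d := 𝓕 f with hh
  have hK : ((fourierConst d : ℝ) : ℂ) ≠ 0 :=
    Complex.ofReal_ne_zero.2 (fourierConst_pos (d := d)).ne'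
  have hfhat : ∀ ω, fhat f ω = (fourierConst d : ℂ) * h ((2 * Real.pi)⁻¹ • ω) := fun ω => rfl
  have hpi : (2 * Real.pi) ≠ 0 := by positivity
  have hint : Integrable (h : Space d → ℂ) := by
    have h1 := ((integrable_comp_smul_iff volume (fhat f) hpi).2 (integrable_fhat hf)).const_mul
      ((fourierConst d : ℂ)⁻¹)
    refine h1.congr (.of_forall fun ω => ?_)
    simp only [hfhat]
    rw [smul_smul, inv_mul_cancel₀ hpi, one_smul, inv_mul_cancel_left₀ hK]
  have h2 := Lp_fourierInv_ae_eq h hint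
  rw [show 𝓕⁻ h = f from fourierInv_fourier_eq f] at h2
  refine h2.trans (.of_forall fun x => ?_)
  rw [Real.fourierInv_eq']
  have h3 := Measure.integral_comp_smul (volume : Measure (Space d))
    (fun v : Space d => Complex.exp (↑(2 * Real.pi * inner ℝ v x) * Complex.I) • h v)
    (2 * Real.pi)⁻¹
  have h4 : ∫ ω, fhat f ω * Complex.exp (Complex.I * (inner ℝ x ω : ℝ)) =
      (fourierConst d : ℂ) * ∫ ω : Space d,
        Complex.exp (↑(2 * Real.pi * inner ℝ ((2 * Real.pi)⁻¹ • ω) x) * Complex.I) •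
          h ((2 * Real.pi)⁻¹ • ω) := by
    rw [← integral_const_mul]
    refine integral_congr_ae (.of_forall fun ω => ?_)
    simp only [hfhat]
    rw [inner_smul_left, real_inner_comm]
    simp only [conj_trivial, mul_inv_cancel_left₀ hpi, smul_eq_mul]
    ring_nf
  beta_reduce
  rw [h4, h3]
  have h5 : |((2 * Real.pi)⁻¹ ^ Module.finrank ℝ (Space d))⁻¹| = (2 * Real.pi) ^ d := by
    rw [finrank_euclideanSpace_fin, inv_pow, inv_inv, abs_of_pos (by positivity)]
  rw [h5, ← mul_assoc, Complex.real_smul, ← mul_assoc, ← Complex.ofReal_mul, ← Complex.ofReal_mul,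
    fourierConst_mul_self_mul, Complex.ofReal_one, one_mul]

lemma interpolates_iff {f : L2 d} (hf : f ∈ bandLimited d σ) (X : Finset (Space d)) (Y : X → ℝ) :
    Interpolates f X Y ↔ ∀ x : X, (fourierConst d : ℂ) *
      ∫ ω, fhat f ω * Complex.exp (Complex.I * (inner ℝ (x : Space d) ω : ℝ)) = (Y x : ℂ) := by
  have hc := (continuous_integral_mul_exp_I (integrable_fhat hf)).const_mul (fourierConst d : ℂ)
  have hae := ae_eq_integral_fhat hf
  constructor
  · rintro ⟨g, hg, hfg, hY⟩ x
    have := (Continuous.ae_eq_iff_eq volume hg hc).1 (hfg.symm.trans hae)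
    rw [← hY x, this]
  · exact fun h => ⟨_, hc, hae, h⟩

end Fhat

/-! ### The spectral profile -/

section Profile
variable {d : ℕ} {σ : ℝ} {f : L2 d}

lemma measurableSet_spectralShell (θ σ : ℝ) : MeasurableSet (spectralShell d θ σ) := by
  have h : Measurable fun ω : Space d => ‖ω‖ / σ := by fun_prop
  exact (measurableSet_le measurable_const h).inter (measurableSet_le h measurable_const)

/-- The set whose supremum is the spectral median. -/
def medianSet (σ t : ℝ) (f : L2 d) : Set ℝ :=
  {θ : ℝ | θ ∈ Set.Icc (0 : ℝ) 1 ∧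
    1 / 2 * sobolevNorm t f ^ 2 ≤ ∫ ω in spectralShell d θ σ, sobolevDensity t f ω}

lemma half_sobolevNorm_sq_le_iff (hf : f ∈ bandLimited d σ) (θ t : ℝ) :
    1 / 2 * sobolevNorm t f ^ 2 ≤ ∫ ω in spectralShell d θ σ, sobolevDensity t f ω ↔
      ∫ ω in (spectralShell d θ σ)ᶜ, sobolevDensity t f ω ≤
        ∫ ω in spectralShell d θ σ, sobolevDensity t f ω := by
  rw [sobolevNorm_sq, ← integral_add_compl (measurableSet_spectralShell θ σ)
    (integrable_sobolevDensity hf t)]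
  constructor <;> intro h <;> linarith

/-- Outside the shell a band-limited function only has frequencies below `θσ`. -/
lemma norm_lt_of_notMem_spectralShell (hσ : 0 < σ) {θ : ℝ} {ω : Space d}
    (hω : ω ∉ spectralShell d θ σ) (h : ¬ σ < ‖ω‖) : ‖ω‖ < θ * σ := by
  by_contra hn
  exact hω ⟨(le_div_iff₀ hσ).2 (not_lt.1 hn), (div_le_one hσ).2 (not_lt.1 h)⟩

lemma zero_mem_medianSet (hσ : 0 < σ) (hf : f ∈ bandLimited d σ) (t : ℝ) :
    0 ∈ medianSet σ t f := by
  refine ⟨⟨le_rfl, zero_le_one⟩, (half_sobolevNorm_sq_le_iff hf 0 t).2 ?_⟩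
  have h0 : ∫ ω in (spectralShell d 0 σ)ᶜ, sobolevDensity t f ω = 0 := by
    refine setIntegral_eq_zero_of_ae_eq_zero ?_
    filter_upwards [hf] with ω hω hn
    by_cases h : σ < ‖ω‖
    · simp [sobolevDensity, hω h]
    · have := norm_lt_of_notMem_spectralShell hσ hn h
      linarith [norm_nonneg ω]
  rw [h0]
  exact integral_nonneg fun ω => sobolevDensity_nonneg t f ω

lemma sobolevDensity_eq_rpow_sub_mul (s t : ℝ) (f : L2 d) (ω : Space d) :
    sobolevDensity t f ω = (1 + ‖ω‖ ^ 2) ^ (t - s) * sobolevDensity s f ω := by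
  unfold sobolevDensity
  rw [← mul_assoc, ← Real.rpow_add (by positivity)]
  ring_nf

/-- Raising the order shifts the Sobolev density to higher frequencies: passing from order `s` to
order `t` multiplies the density by at least `(1 + (θσ)²)^(t - s)` in the shell, and by at most
that outside of it. -/
lemma medianSet_mono (hσ : 0 < σ) (hf : f ∈ bandLimited d σ) {s t : ℝ} (hst : s ≤ t) :
    medianSet σ s f ⊆ medianSet σ t f := by
  rintro θ ⟨hθ, h⟩
  refine ⟨hθ, ?_⟩
  rw [half_sobolevNorm_sq_le_iff hf] at h ⊢
  have hm := measurableSet_spectralShell (d := d) θ σ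
  set k : ℝ := (1 + (θ * σ) ^ 2) ^ (t - s)
  have hts : 0 ≤ t - s := by linarith
  have hi := fun t => integrable_sobolevDensity hf t
  have hθσ : 0 ≤ θ * σ := mul_nonneg hθ.1 hσ.le
  calc _ ≤ ∫ ω in (spectralShell d θ σ)ᶜ, k * sobolevDensity s f ω := by
        refine setIntegral_mono_on_ae (hi t).integrableOn ((hi s).const_mul k).integrableOn
          hm.compl ?_
        filter_upwards [hf] with ω hω hn
        by_cases hs : σ < ‖ω‖
        · simp [sobolevDensity, hω hs]
        · have := norm_lt_of_notMem_spectralShell hσ hn hs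
          rw [sobolevDensity_eq_rpow_sub_mul s]
          refine mul_le_mul_of_nonneg_right ?_ (sobolevDensity_nonneg s f ω)
          simp only [k]
          gcongr
    _ ≤ k * ∫ ω in spectralShell d θ σ, sobolevDensity s f ω := by
        rw [integral_const_mul]
        gcongr
    _ ≤ _ := by
        rw [← integral_const_mul]
        refine setIntegral_mono_on ((hi s).const_mul k).integrableOn (hi t).integrableOn hm
          fun ω hω => ?_
        rw [sobolevDensity_eq_rpow_sub_mul s t]
        refine mul_le_mul_of_nonneg_right ?_ (sobolevDensity_nonneg s f ω)
        have := (le_div_iff₀ hσ).1 hω.1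
        simp only [k]
        gcongr

lemma bddAbove_medianSet (t : ℝ) : BddAbove (medianSet σ t f) := ⟨1, fun _ h => h.1.2⟩

lemma spectralMedian_nonneg (t : ℝ) : 0 ≤ spectralMedian σ t f :=
  Real.sSup_nonneg fun _ h => h.1.1

lemma spectralMedian_mono (hσ : 0 < σ) (hf : f ∈ bandLimited d σ) :
    Monotone fun t => spectralMedian σ t f := fun _ _ h =>
  csSup_le_csSup (bddAbove_medianSet _) ⟨0, zero_mem_medianSet hσ hf _⟩ (medianSet_mono hσ hf h)

lemma continuous_log_one_add_sq : Continuous fun ω : Space d => Real.log (1 + ‖ω‖ ^ 2) :=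
  Continuous.log (by fun_prop) fun ω => by positivity

lemma hasDerivAt_sobolevNorm_sq (hf : f ∈ bandLimited d σ) (t : ℝ) :
    HasDerivAt (fun t => sobolevNorm t f ^ 2)
      (∫ ω, Real.log (1 + ‖ω‖ ^ 2) * sobolevDensity t f ω) t := by
  simp_rw [sobolevNorm_sq]
  refine (hasDerivAt_integral_of_dominated_loc_of_deriv_le (s := Metric.ball t 1)
    (F' := fun t ω => Real.log (1 + ‖ω‖ ^ 2) * sobolevDensity t f ω)
    (bound := fun ω => (Real.log (1 + ‖ω‖ ^ 2) * (1 + ‖ω‖ ^ 2) ^ (t + 1)) * ‖fhat f ω‖ ^ 2)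
    (Metric.ball_mem_nhds t one_pos) ?_ (integrable_sobolevDensity hf t) ?_ ?_ ?_ ?_).2
  · exact .of_forall fun s => (integrable_sobolevDensity hf s).1
  · exact continuous_log_one_add_sq.aestronglyMeasurable.mul (integrable_sobolevDensity hf t).1
  · refine .of_forall fun ω s hs => ?_
    have h1 : (1 : ℝ) ≤ 1 + ‖ω‖ ^ 2 := by nlinarith [sq_nonneg ‖ω‖]
    have hl := Real.log_nonneg h1
    rw [Real.norm_of_nonneg (mul_nonneg hl (sobolevDensity_nonneg s f ω)), sobolevDensity,
      ← mul_assoc]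
    gcongr
    rw [Metric.mem_ball, Real.dist_eq] at hs
    linarith [(abs_lt.1 hs).2]
  · exact integrable_mul_norm_fhat_sq hf
      (continuous_log_one_add_sq.mul (continuous_one_add_sq_rpow _))
  · refine .of_forall fun ω s _ => ?_
    have h := ((hasStrictDerivAt_id s).hasDerivAt.const_rpow
      (a := 1 + ‖ω‖ ^ 2) (by positivity)).mul_const (‖fhat f ω‖ ^ 2)
    refine h.congr_deriv ?_
    simp only [sobolevDensity, id]
    ring

/-- At least half of the squared norm sits at frequencies `≥ β_t σ`, whence the logarithmic
derivative of `t ↦ ‖f‖²_{H^t}` is at least `½ log (1 + (β_t σ)²)`. -/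
lemma half_log_mul_sobolevNorm_sq_le (hσ : 0 < σ) (hf : f ∈ bandLimited d σ) (t : ℝ) :
    1 / 2 * Real.log (1 + (spectralMedian σ t f * σ) ^ 2) * sobolevNorm t f ^ 2 ≤
      ∫ ω, Real.log (1 + ‖ω‖ ^ 2) * sobolevDensity t f ω := by
  set J := ∫ ω, Real.log (1 + ‖ω‖ ^ 2) * sobolevDensity t f ω with hJ
  have hlog : ∀ r : ℝ, 0 ≤ Real.log (1 + r ^ 2) := fun r =>
    Real.log_nonneg (by nlinarith [sq_nonneg r])
  have hi : Integrable fun ω => Real.log (1 + ‖ω‖ ^ 2) * sobolevDensity t f ω := by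
    have := integrable_mul_norm_fhat_sq hf
      (continuous_log_one_add_sq.mul (continuous_one_add_sq_rpow (d := d) t))
    simpa only [sobolevDensity, Pi.mul_apply, mul_assoc] using this
  -- the inequality with `θ` in place of the median is a closed condition that holds on the set whose
  -- supremum is the median
  have hclosed : IsClosed {θ : ℝ |
      1 / 2 * Real.log (1 + (θ * σ) ^ 2) * sobolevNorm t f ^ 2 ≤ J} := by
    refine isClosed_le ?_ continuous_const
    refine (continuous_const.mul (Continuous.log (by fun_prop) fun θ => ?_)).mul continuous_const
    positivity
  have hsub : medianSet σ t f ⊆ {θ : ℝ |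
      1 / 2 * Real.log (1 + (θ * σ) ^ 2) * sobolevNorm t f ^ 2 ≤ J} := by
    rintro θ ⟨hθ, h⟩
    have hθσ : 0 ≤ θ * σ := mul_nonneg hθ.1 hσ.le
    calc 1 / 2 * Real.log (1 + (θ * σ) ^ 2) * sobolevNorm t f ^ 2
        = Real.log (1 + (θ * σ) ^ 2) * (1 / 2 * sobolevNorm t f ^ 2) := by ring
      _ ≤ Real.log (1 + (θ * σ) ^ 2) *
          ∫ ω in spectralShell d θ σ, sobolevDensity t f ω := by
          gcongr
          exact hlog _
      _ ≤ ∫ ω in spectralShell d θ σ, Real.log (1 + ‖ω‖ ^ 2) * sobolevDensity t f ω := by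
          rw [← integral_const_mul]
          refine setIntegral_mono_on ((integrable_sobolevDensity hf t).const_mul _).integrableOn
            hi.integrableOn (measurableSet_spectralShell θ σ) fun ω hω => ?_
          refine mul_le_mul_of_nonneg_right ?_ (sobolevDensity_nonneg t f ω)
          have := (le_div_iff₀ hσ).1 hω.1
          gcongr
      _ ≤ J := setIntegral_le_integral hi
          (.of_forall fun ω => mul_nonneg (hlog _) (sobolevDensity_nonneg t f ω))
  exact closure_minimal hsub hclosed
    (csSup_mem_closure ⟨0, zero_mem_medianSet hσ hf t⟩ (bddAbove_medianSet t))

lemma sobolevNorm_nonneg (t : ℝ) (f : L2 d) : 0 ≤ sobolevNorm t f := Real.sqrt_nonneg _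

lemma sobolevNorm_zero (t : ℝ) : sobolevNorm t (0 : L2 d) = 0 := by
  have h := fhat_sub_ae (0 : L2 d) 0
  rw [sub_zero] at h
  have : ∫ ω, sobolevDensity t (0 : L2 d) ω = 0 := by
    refine integral_eq_zero_of_ae ?_
    filter_upwards [h] with ω hω
    rw [sobolevDensity, hω, sub_self, norm_zero, zero_pow two_ne_zero, mul_zero, Pi.zero_apply]
  rw [sobolevNorm, this, Real.sqrt_zero]

/-- The profile inequality: the growth of the Sobolev norms of a band-limited function in the order
is at least exponential, at the rate given by the spectral medians. -/
theorem sobolevNorm_mul_exp_le (hσ : 0 < σ) (hf : f ∈ bandLimited d σ) {a b : ℝ} (hab : a ≤ b) :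
    IntervalIntegrable (fun t => Real.log (1 + (spectralMedian σ t f * σ) ^ 2)) volume a b ∧
    sobolevNorm a f * Real.exp (1 / 4 * ∫ t in a..b,
      Real.log (1 + (spectralMedian σ t f * σ) ^ 2)) ≤ sobolevNorm b f := by
  have hmono : Monotone fun t => Real.log (1 + (spectralMedian σ t f * σ) ^ 2) := by
    intro s t hst
    have h1 := spectralMedian_mono hσ hf hst
    have h0 := spectralMedian_nonneg (σ := σ) (f := f) s
    simp only at h1 ⊢
    gcongr
  have hint := hmono.intervalIntegrable (μ := volume) (a := a) (b := b)
  refine ⟨hint, ?_⟩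
  by_cases hf0 : f = 0
  · simp [hf0, sobolevNorm_zero]
  have hpos : ∀ t, 0 < sobolevNorm t f := fun t =>
    (sobolevNorm_nonneg t f).lt_of_ne' fun h => hf0 (eq_zero_of_sobolevNorm_eq_zero hf h)
  have hderiv : ∀ t, HasDerivAt (fun t => Real.log (sobolevNorm t f ^ 2))
      ((∫ ω, Real.log (1 + ‖ω‖ ^ 2) * sobolevDensity t f ω) / sobolevNorm t f ^ 2) t := fun t =>
    (hasDerivAt_sobolevNorm_sq hf t).log (pow_pos (hpos t) 2).ne'
  have key := intervalIntegral.integral_le_sub_of_hasDeriv_right_of_le hab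
    (fun t _ => (hderiv t).continuousAt.continuousWithinAt)
    (fun t _ => (hderiv t).hasDerivWithinAt)
    (φ := fun t => 1 / 2 * Real.log (1 + (spectralMedian σ t f * σ) ^ 2))
    ((intervalIntegrable_iff_integrableOn_Icc_of_le hab).1 (hint.const_mul _))
    (fun t _ => (le_div_iff₀ (pow_pos (hpos t) 2)).2 (half_log_mul_sobolevNorm_sq_le hσ hf t))
  rw [intervalIntegral.integral_const_mul, Real.log_pow, Real.log_pow] at key
  rw [← Real.exp_log (hpos a), ← Real.exp_add, ← Real.le_log_iff_exp_le (hpos b)]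
  push_cast at key
  linarith

end Profile

/-! ### Minimal interpolants -/

/-- A linear system with positive definite matrix is uniquely solvable. -/
lemma existsUnique_of_posDef {ι : Type*} [Fintype ι] (k : ι → ι → ℝ)
    (hk : ∀ a : ι → ℝ, a ≠ 0 → 0 < ∑ x, ∑ y, a x * a y * k x y) (Y : ι → ℝ) :
    ∃! a : ι → ℝ, ∀ x, ∑ y, a y * k x y = Y x := by
  set T : (ι → ℝ) →ₗ[ℝ] (ι → ℝ) :=
    { toFun := fun a x => ∑ y, a y * k x y
      map_add' := fun a b => by ext x; simp [add_mul, Finset.sum_add_distrib]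
      map_smul' := fun r a => by ext x; simp [mul_assoc, Finset.mul_sum] } with hT
  have hinj : Function.Injective T := by
    rw [injective_iff_map_eq_zero]
    intro a ha
    by_contra h
    refine (hk a h).ne' ?_
    simp_rw [mul_assoc, ← Finset.mul_sum]
    refine Finset.sum_eq_zero fun x _ => ?_
    have : ∑ y, a y * k x y = 0 := congrFun ha x
    rw [this, mul_zero]
  have hbij : Function.Bijective T := ⟨hinj, LinearMap.injective_iff_surjective.1 hinj⟩
  simpa [hT, funext_iff] using hbij.existsUnique Y

section BandKernel
variable {d : ℕ}

/-- The weight `(1 + ‖ω‖²)^(-t)`, cut off to the ball of radius `σ`. -/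
noncomputable def ballWeight (d : ℕ) (σ t : ℝ) : Space d → ℝ :=
  (Metric.closedBall 0 σ).indicator fun ω => (1 + ‖ω‖ ^ 2) ^ (-t)

lemma integrable_ballWeight (σ t : ℝ) : Integrable (ballWeight d σ t) :=
  (integrable_indicator_iff Metric.isClosed_closedBall.measurableSet).2
    (ContinuousOn.integrableOn_compact (isCompact_closedBall _ _)
      (continuous_one_add_sq_rpow (-t)).continuousOn)

lemma ballWeight_neg (σ t : ℝ) (ω : Space d) : ballWeight d σ t (-ω) = ballWeight d σ t ω := by
  classical
  unfold ballWeight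
  simp only [Set.indicator_apply, mem_closedBall_zero_iff, norm_neg]

/-- The reproducing kernel of `B_σ` with the `H^t`-norm. The integral is real, as its weight is
even. -/
noncomputable def bandKernel (d : ℕ) (σ t : ℝ) (x y : Space d) : ℝ :=
  fourierConst d ^ 2 *
    (∫ ω, (ballWeight d σ t ω : ℂ) * Complex.exp (Complex.I * (inner ℝ (x - y) ω : ℝ))).re

lemma ofReal_bandKernel (σ t : ℝ) (x y : Space d) : (bandKernel d σ t x y : ℂ) =
    (fourierConst d : ℂ) ^ 2 *
      ∫ ω, (ballWeight d σ t ω : ℂ) * Complex.exp (Complex.I * (inner ℝ (x - y) ω : ℝ)) := by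
  rw [bandKernel, Complex.ofReal_mul, Complex.ofReal_pow]
  congr 1
  rw [← Complex.conj_eq_iff_re, ← integral_conj, ← integral_neg_eq_self]
  refine integral_congr_ae (.of_forall fun ω => ?_)
  simp only [map_mul, Complex.conj_ofReal, ← Complex.exp_conj, Complex.conj_I, inner_neg_right,
    ballWeight_neg]
  push_cast
  ring_nf

lemma sum_bandKernel (σ t : ℝ) (X : Finset (Space d)) (a : X → ℝ) :
    ∑ x : X, ∑ y : X, a x * a y * bandKernel d σ t x y =
      fourierConst d ^ 2 * ∫ ω in Metric.closedBall 0 σ,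
        (1 + ‖ω‖ ^ 2) ^ (-t) * ‖expSum X a ω‖ ^ 2 := by
  have h := integral_mul_norm_expSum_sq X a (integrable_ballWeight (d := d) σ t)
  have h2 : ∫ ω, ballWeight d σ t ω * ‖expSum X a ω‖ ^ 2 = ∫ ω in Metric.closedBall 0 σ,
      (1 + ‖ω‖ ^ 2) ^ (-t) * ‖expSum X a ω‖ ^ 2 := by
    rw [← integral_indicator Metric.isClosed_closedBall.measurableSet]
    refine integral_congr_ae (.of_forall fun ω => ?_)
    simp only [ballWeight, Set.indicator_mul_left]
  rw [← h2, ← Complex.ofReal_inj, Complex.ofReal_mul, h, Complex.ofReal_pow]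
  push_cast
  simp_rw [ofReal_bandKernel, Finset.mul_sum]
  refine Finset.sum_congr rfl fun x _ => Finset.sum_congr rfl fun y _ => ?_
  ring

/-- The Fourier transform of the combination of kernel translates with coefficients `a`. -/
lemma exists_fhat_ae_eq_ballWeight (σ t : ℝ) (X : Finset (Space d)) (a : X → ℝ) :
    ∃ f ∈ bandLimited d σ, fhat f =ᵐ[volume] fun ω =>
      (ballWeight d σ t ω : ℂ) * ((fourierConst d : ℂ) * starRingEnd ℂ (expSum X a ω)) := by
  have hB := (Metric.isClosed_closedBall (x := (0 : Space d)) (ε := σ)).measurableSet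
  have hmem : MemLp (fun ω =>
      (ballWeight d σ t ω : ℂ) * ((fourierConst d : ℂ) * starRingEnd ℂ (expSum X a ω)))
      2 volume := by
    have e : (fun ω => (ballWeight d σ t ω : ℂ) *
        ((fourierConst d : ℂ) * starRingEnd ℂ (expSum X a ω))) =
        (Metric.closedBall 0 σ).indicator fun ω => (((1 + ‖ω‖ ^ 2) ^ (-t) : ℝ) : ℂ) *
          ((fourierConst d : ℂ) * starRingEnd ℂ (expSum X a ω)) := by
      ext ω
      by_cases h : ω ∈ Metric.closedBall 0 σ <;> simp [ballWeight, h]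
    rw [e, memLp_indicator_iff_restrict hB]
    have hw := continuous_one_add_sq_rpow (d := d) (-t)
    have hc : Continuous fun ω : Space d => (((1 + ‖ω‖ ^ 2) ^ (-t) : ℝ) : ℂ) *
        ((fourierConst d : ℂ) * starRingEnd ℂ (expSum X a ω)) :=
      (Complex.continuous_ofReal.comp hw).mul (continuous_const.mul
        (Complex.continuous_conj.comp (continuous_expSum X a)))
    obtain ⟨M, hM⟩ := (isCompact_closedBall (0 : Space d) σ).exists_bound_of_continuousOn
      hc.continuousOn
    have : IsFiniteMeasure (volume.restrict (Metric.closedBall (0 : Space d) σ)) :=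
      ⟨by simpa using measure_closedBall_lt_top⟩
    exact MemLp.of_bound hc.aestronglyMeasurable M ((ae_restrict_iff' hB).2 (.of_forall hM))
  obtain ⟨f, hf⟩ := exists_fhat_ae_eq hmem
  refine ⟨f, ?_, hf⟩
  have : ∀ᵐ ω : Space d, σ < ‖ω‖ → fhat f ω = 0 := by
    filter_upwards [hf] with ω hω h
    rw [hω, ballWeight, Set.indicator_of_notMem (by simpa using h)]
    simp
  exact this

lemma interpolates_sub {f g : L2 d} {X : Finset (Space d)} {Y Z : X → ℝ}
    (hf : Interpolates f X Y) (hg : Interpolates g X Z) : Interpolates (f - g) X (Y - Z) := by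
  obtain ⟨u, hu, hfu, hY⟩ := hf
  obtain ⟨v, hv, hgv, hZ⟩ := hg
  refine ⟨u - v, hu.sub hv, (Lp.coeFn_sub f g).trans (hfu.sub hgv), fun x => ?_⟩
  simp [hY, hZ]

variable {σ t : ℝ} {X : Finset (Space d)} {a : X → ℝ} {f : L2 d}

lemma interpolates_of_fhat_ae_eq (hf : f ∈ bandLimited d σ)
    (hfa : fhat f =ᵐ[volume] fun ω =>
      (ballWeight d σ t ω : ℂ) * ((fourierConst d : ℂ) * starRingEnd ℂ (expSum X a ω)))
    {Y : X → ℝ} (ha : ∀ x : X, ∑ y : X, a y * bandKernel d σ t x y = Y x) :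
    Interpolates f X Y := by
  rw [interpolates_iff hf]
  intro x
  rw [← ha x]
  push_cast
  simp_rw [ofReal_bandKernel, ← integral_const_mul]
  rw [← integral_finsetSum _ fun y _ => ((integrable_mul_exp_I
    (integrable_ballWeight σ t) _).const_mul _).const_mul _]
  refine integral_congr_ae ?_
  filter_upwards [hfa] with ω hω
  rw [hω, expSum, map_sum]
  simp only [Finset.mul_sum, Finset.sum_mul]
  refine Finset.sum_congr rfl fun y _ => ?_
  rw [map_mul, Complex.conj_ofReal, ← Complex.exp_conj, map_mul, Complex.conj_I,
    Complex.conj_ofReal, inner_sub_left,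
    show Complex.I * ((inner ℝ (x : Space d) ω - inner ℝ (y : Space d) ω : ℝ) : ℂ) =
      -Complex.I * (inner ℝ (y : Space d) ω : ℝ) + Complex.I * (inner ℝ (x : Space d) ω : ℝ) by
        push_cast; ring, Complex.exp_add]
  ring

/-- The reproducing property: the `H^t`-pairing of a band-limited function with a combination of
kernel translates is the combination of its values. -/
lemma pairing_eq_sum (hfa : fhat f =ᵐ[volume] fun ω =>
      (ballWeight d σ t ω : ℂ) * ((fourierConst d : ℂ) * starRingEnd ℂ (expSum X a ω)))
    {g : L2 d} (hg : g ∈ bandLimited d σ) {Y : X → ℝ} (hY : Interpolates g X Y) :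
    Integrable (fun ω => (((1 + ‖ω‖ ^ 2) ^ t : ℝ) : ℂ) *
      (fhat g ω * starRingEnd ℂ (fhat f ω))) ∧
    ∫ ω, (((1 + ‖ω‖ ^ 2) ^ t : ℝ) : ℂ) * (fhat g ω * starRingEnd ℂ (fhat f ω)) =
      ((∑ x, a x * Y x : ℝ) : ℂ) := by
  have hi : ∀ x : X, Integrable fun ω => (a x : ℂ) * ((fourierConst d : ℂ) *
      (fhat g ω * Complex.exp (Complex.I * (inner ℝ (x : Space d) ω : ℝ)))) := by
    intro x
    refine Integrable.const_mul (Integrable.const_mul ?_ _) _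
    refine (integrable_fhat hg).mul_bdd (c := 1) (by fun_prop) (.of_forall fun ω => ?_)
    rw [mul_comm Complex.I, Complex.norm_exp_ofReal_mul_I]
  have hae : (fun ω => (((1 + ‖ω‖ ^ 2) ^ t : ℝ) : ℂ) * (fhat g ω * starRingEnd ℂ (fhat f ω)))
      =ᵐ[volume] fun ω => ∑ x : X, (a x : ℂ) * ((fourierConst d : ℂ) *
        (fhat g ω * Complex.exp (Complex.I * (inner ℝ (x : Space d) ω : ℝ)))) := by
    filter_upwards [hfa, hg] with ω h1 h2
    by_cases hω : σ < ‖ω‖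
    · simp [h2 hω]
    · have hmem : ω ∈ Metric.closedBall (0 : Space d) σ := by simpa using hω
      have hw : (((1 + ‖ω‖ ^ 2) ^ t : ℝ) : ℂ) * (((1 + ‖ω‖ ^ 2) ^ (-t) : ℝ) : ℂ) = 1 := by
        rw [← Complex.ofReal_mul, ← Real.rpow_add (by positivity)]
        simp
      rw [h1, ballWeight, Set.indicator_of_mem hmem]
      simp only [map_mul, Complex.conj_ofReal, Complex.conj_conj]
      calc _ = ((((1 + ‖ω‖ ^ 2) ^ t : ℝ) : ℂ) * (((1 + ‖ω‖ ^ 2) ^ (-t) : ℝ) : ℂ)) *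
            ((fourierConst d : ℂ) * fhat g ω * expSum X a ω) := by ring
        _ = _ := by
            rw [hw, one_mul, expSum, Finset.mul_sum]
            refine Finset.sum_congr rfl fun x _ => ?_
            ring
  refine ⟨(integrable_congr hae).2 (integrable_finsetSum _ fun x _ => hi x), ?_⟩
  rw [integral_congr_ae hae, integral_finsetSum _ fun x _ => hi x]
  push_cast
  refine Finset.sum_congr rfl fun x _ => ?_
  rw [integral_const_mul, integral_const_mul, (interpolates_iff hg X Y).1 hY x]

/-- The minimal `H^t`-interpolant in `B_σ`: a combination of kernel translates whose norm is given
by the quadratic form, and from which every interpolant differs orthogonally. -/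
lemma exists_bandLimited_interpolant {Y : X → ℝ}
    (ha : ∀ x : X, ∑ y : X, a y * bandKernel d σ t x y = Y x) :
    ∃ f ∈ bandLimited d σ, Interpolates f X Y ∧ sobolevNorm t f ^ 2 = ∑ x, a x * Y x ∧
      ∀ g ∈ bandLimited d σ, Interpolates g X Y →
        sobolevNorm t g ^ 2 = sobolevNorm t f ^ 2 + sobolevNorm t (g - f) ^ 2 := by
  obtain ⟨f, hf, hfa⟩ := exists_fhat_ae_eq_ballWeight σ t X a
  have hfY := interpolates_of_fhat_ae_eq hf hfa ha
  refine ⟨f, hf, hfY, ?_, fun g hg hgY => ?_⟩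
  · have h := (pairing_eq_sum hfa hf hfY).2
    rw [← Complex.ofReal_inj, ← h, sobolevNorm_sq, ← integral_complex_ofReal]
    refine integral_congr_ae (.of_forall fun ω => ?_)
    simp only [sobolevDensity, Complex.mul_conj']
    push_cast
    rfl
  · -- `g - f` interpolates zero data, so that it is orthogonal to `f`
    have hD := sub_mem_bandLimited hg hf
    obtain ⟨hi, h0⟩ := pairing_eq_sum hfa hD (interpolates_sub hgY hfY)
    have hre : ∫ ω, ((((1 + ‖ω‖ ^ 2) ^ t : ℝ) : ℂ) *
        (fhat (g - f) ω * starRingEnd ℂ (fhat f ω))).re = 0 := by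
      have := integral_re hi
      simp only [RCLike.re_to_complex] at this
      rw [this, h0]
      simp
    simp only [sobolevNorm_sq]
    have hif := integrable_sobolevDensity hf t
    have hiD := integrable_sobolevDensity hD t
    have : ∫ ω, sobolevDensity t g ω = ∫ ω, (sobolevDensity t f ω + sobolevDensity t (g - f) ω +
        2 * ((((1 + ‖ω‖ ^ 2) ^ t : ℝ) : ℂ) *
          (fhat (g - f) ω * starRingEnd ℂ (fhat f ω))).re) := by
      refine integral_congr_ae ?_
      filter_upwards [fhat_sub_ae g f] with ω hω
      have hgω : fhat g ω = fhat (g - f) ω + fhat f ω := by rw [hω]; ring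
      simp only [sobolevDensity, Complex.re_ofReal_mul]
      rw [hgω, ← Complex.normSq_eq_norm_sq, ← Complex.normSq_eq_norm_sq,
        ← Complex.normSq_eq_norm_sq, Complex.normSq_add]
      ring
    have hi2 : Integrable fun ω => 2 * ((((1 + ‖ω‖ ^ 2) ^ t : ℝ) : ℂ) *
        (fhat (g - f) ω * starRingEnd ℂ (fhat f ω))).re := hi.re.const_mul 2
    have hif2 : Integrable fun ω => sobolevDensity t f ω + sobolevDensity t (g - f) ω :=
      hif.add hiD
    rw [this, integral_add hif2 hi2, integral_add hif hiD, integral_const_mul, hre]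
    ring

/-- Existence and uniqueness of the minimal `H^t`-interpolant in `B_σ`. -/
lemma existsUnique_isMinBandLimited
    (hpos : ∀ c : X → ℝ, c ≠ 0 → 0 < ∫ ω in Metric.closedBall 0 σ,
      (1 + ‖ω‖ ^ 2) ^ (-t) * ‖expSum X c ω‖ ^ 2) (Y : X → ℝ) :
    ∃! f : L2 d, IsMinBandLimited σ t X Y f := by
  obtain ⟨a, ha, -⟩ := existsUnique_of_posDef
    (fun x y : X => bandKernel d σ t x y) (fun c hc => by
      rw [sum_bandKernel]
      have := fourierConst_pos (d := d)
      exact mul_pos (by positivity) (hpos c hc)) Y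
  obtain ⟨f, hf, hfY, -, horth⟩ := exists_bandLimited_interpolant ha
  refine ⟨f, ⟨hf, hfY, fun g hg hgY => ?_⟩, fun g hg => ?_⟩
  · refine le_of_sq_le_sq ?_ (sobolevNorm_nonneg t g)
    rw [horth g hg hgY]
    exact le_add_of_nonneg_right (sq_nonneg _)
  · have h1 := horth g hg.mem hg.interp
    have h2 : sobolevNorm t g ^ 2 ≤ sobolevNorm t f ^ 2 :=
      pow_le_pow_left₀ (sobolevNorm_nonneg t g) (hg.le f hf hfY) 2
    have h3 : sobolevNorm t (g - f) = 0 := by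
      rw [← sq_eq_zero_iff]
      exact le_antisymm (by linarith) (sq_nonneg _)
    exact sub_eq_zero.1 (eq_zero_of_sobolevNorm_eq_zero (sub_mem_bandLimited hg.mem hf) h3)

end BandKernel

section NativeSpace
variable {d : ℕ} {N : Type} [NormedAddCommGroup N] [InnerProductSpace ℝ N] [CompleteSpace N]
  [RKHS ℝ N (Space d) ℝ] {K : Space d → Space d → ℝ} {X : Finset (Space d)}

lemma sum_kerFun_apply (hN : IsNativeSpace N K) (a : X → ℝ) (x : Space d) :
    (∑ y : X, a y • RKHS.kerFun N (y : Space d) (1 : ℝ)) x = ∑ y : X, a y * K x y := by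
  rw [← RKHS.coeCLM_apply (𝕜 := ℝ), map_sum, Finset.sum_apply]
  refine Finset.sum_congr rfl fun y _ => ?_
  rw [map_smul, Pi.smul_apply, RKHS.coeCLM_apply, RKHS.kerFun_apply, hN, smul_eq_mul]

lemma inner_sum_kerFun (a : X → ℝ) (u : N) :
    inner ℝ (∑ y : X, a y • RKHS.kerFun N (y : Space d) (1 : ℝ)) u = ∑ y : X, a y * u y := by
  simp [sum_inner, inner_smul_left]

lemma norm_sum_kerFun_sq (hN : IsNativeSpace N K) (a : X → ℝ) :
    ‖∑ y : X, a y • RKHS.kerFun N (y : Space d) (1 : ℝ)‖ ^ 2 =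
      ∑ x : X, ∑ y : X, a x * a y * K x y := by
  rw [← real_inner_self_eq_norm_sq, inner_sum_kerFun]
  refine Finset.sum_congr rfl fun x _ => ?_
  rw [sum_kerFun_apply hN, Finset.mul_sum]
  simp_rw [mul_assoc]

lemma mem_trial_iff (u : N) :
    u ∈ Submodule.span ℝ ((fun x : Space d => RKHS.kerFun N x (1 : ℝ)) '' X) ↔
      ∃ a : X → ℝ, ∑ y : X, a y • RKHS.kerFun N (y : Space d) (1 : ℝ) = u := by
  rw [Set.image_eq_range, Submodule.mem_span_range_iff_exists_fun]
  rfl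

lemma existsUnique_isKernelInterpolant (hN : IsNativeSpace N K)
    (hpos : ∀ c : X → ℝ, c ≠ 0 → 0 < ∑ x : X, ∑ y : X, c x * c y * K x y) (Y : X → ℝ) :
    ∃! u : N, IsKernelInterpolant X Y u := by
  obtain ⟨a, ha, huniq⟩ := existsUnique_of_posDef (fun x y : X => K x y) hpos Y
  refine ⟨∑ y : X, a y • RKHS.kerFun N (y : Space d) (1 : ℝ),
    ⟨(mem_trial_iff _).2 ⟨a, rfl⟩, fun x => ?_⟩, fun u hu => ?_⟩
  · rw [sum_kerFun_apply hN]; exact ha x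
  · obtain ⟨b, rfl⟩ := (mem_trial_iff _).1 hu.mem_trial
    have : b = a := huniq b fun x => by
      rw [← hu.interp x, sum_kerFun_apply hN]
    rw [this]

/-- Comparison of the two variational problems: if the quadratic form of the kernel is at most `L`
times that of the band-limited kernel, then the norms of the minimal interpolants compare the other
way round. -/
lemma sobolevNorm_le_sqrt_mul_norm (hN : IsNativeSpace N K) {σ t L : ℝ} (hL : 0 ≤ L)
    (hpos : ∀ c : X → ℝ, c ≠ 0 → 0 < ∫ ω in Metric.closedBall 0 σ,
      (1 + ‖ω‖ ^ 2) ^ (-t) * ‖expSum X c ω‖ ^ 2)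
    (hle : ∀ c : X → ℝ, ∑ x : X, ∑ y : X, c x * c y * K x y ≤
      L * ∑ x : X, ∑ y : X, c x * c y * bandKernel d σ t x y)
    {Y : X → ℝ} {u : N} (hu : ∀ x : X, u x = Y x) {f : L2 d} (hf : IsMinBandLimited σ t X Y f) :
    sobolevNorm t f ≤ Real.sqrt L * ‖u‖ := by
  obtain ⟨a, ha, -⟩ := existsUnique_of_posDef
    (fun x y : X => bandKernel d σ t x y) (fun c hc => by
      rw [sum_bandKernel]
      have := fourierConst_pos (d := d)
      exact mul_pos (by positivity) (hpos c hc)) Y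
  obtain ⟨g, hg, hgY, hnorm, -⟩ := exists_bandLimited_interpolant ha
  refine (hf.le g hg hgY).trans ?_
  -- duality: `‖g‖²` is the inner product of `v` and `u`, and `‖v‖² ≤ L ‖g‖²`
  set v : N := ∑ y : X, a y • RKHS.kerFun N (y : Space d) (1 : ℝ) with hv
  have h1 : sobolevNorm t g ^ 2 ≤ ‖v‖ * ‖u‖ := by
    refine le_trans (le_of_eq ?_) (real_inner_le_norm v u)
    rw [hnorm, hv, inner_sum_kerFun]
    simp_rw [hu]
  have h2 : ‖v‖ ≤ Real.sqrt L * sobolevNorm t g := by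
    refine le_of_sq_le_sq ?_ (mul_nonneg (Real.sqrt_nonneg _) (sobolevNorm_nonneg t g))
    rw [mul_pow, Real.sq_sqrt hL, hnorm, hv, norm_sum_kerFun_sq hN]
    refine (hle a).trans (le_of_eq ?_)
    congr 1
    refine Finset.sum_congr rfl fun x _ => ?_
    rw [← ha x, Finset.mul_sum]
    simp_rw [mul_assoc]
  rcases (sobolevNorm_nonneg t g).eq_or_lt with h0 | h0
  · rw [← h0]; positivity
  · have h3 : sobolevNorm t g * sobolevNorm t g ≤ (Real.sqrt L * ‖u‖) * sobolevNorm t g := by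
      calc _ = sobolevNorm t g ^ 2 := by ring
        _ ≤ ‖v‖ * ‖u‖ := h1
        _ ≤ Real.sqrt L * sobolevNorm t g * ‖u‖ := by gcongr
        _ = _ := by ring
    exact le_of_mul_le_mul_right h3 h0

end NativeSpace

/-- The quadratic form of a translation-invariant kernel in terms of its symbol. -/
lemma sum_kernel_eq_integral {d : ℕ} {Φ : Space d → Space d → ℝ} {Φhat : Space d → ℝ}
    (hint : Integrable Φhat) (hΦ : ∀ x z, (Φ x z : ℂ) = (((2 * Real.pi) ^ (-(d : ℝ) / 2) : ℝ) : ℂ) *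
      ∫ ω, (Φhat ω : ℂ) * Complex.exp (Complex.I * (inner ℝ (x - z) ω : ℝ)))
    (X : Finset (Space d)) (c : X → ℝ) :
    ∑ x : X, ∑ y : X, c x * c y * Φ x y =
      fourierConst d * ∫ ω, Φhat ω * ‖expSum X c ω‖ ^ 2 := by
  rw [← Complex.ofReal_inj, Complex.ofReal_mul, integral_mul_norm_expSum_sq X c hint]
  push_cast
  simp_rw [hΦ, Finset.mul_sum]
  refine Finset.sum_congr rfl fun x _ => Finset.sum_congr rfl fun y _ => ?_
  rw [fourierConst]
  ring

lemma sepDist_pos {d : ℕ} {X : Finset (Space d)} (hX : X.Nontrivial) : 0 < sepDist X := by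
  have := (Set.Finite.infsep_pos_iff_nontrivial X.finite_toSet).2 hX
  unfold sepDist
  positivity

lemma two_mul_sepDist_le_dist {d : ℕ} {X : Finset (Space d)} {x y : Space d} (hx : x ∈ X)
    (hy : y ∈ X) (hxy : x ≠ y) : 2 * sepDist X ≤ dist x y := by
  have := Set.infsep_le_dist_of_mem (s := (X : Set (Space d))) hx hy hxy
  unfold sepDist
  linarith

/-! ### The lower bound for the native norm -/

theorem mainTheorem1 (d : ℕ) (hd : 0 < d) (m_min m_max : ℝ)
    (h_min : (d : ℝ) / 2 < m_min) (h_le : m_min ≤ m_max) :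
    ∃ κ₀ : ℝ, 0 < κ₀ ∧ ∀ κ : ℝ, κ₀ ≤ κ →
    ∀ (c₁ c₂ : ℝ) (Φ : ℝ → Space d → Space d → ℝ),
      IsAdmissibleFamily (Set.Icc m_min m_max) c₁ c₂ Φ →
    ∀ Ω : Set (Space d), Bornology.IsBounded Ω →
    ∀ s : ℝ, 0 < s →
    ∃ C : ℝ, 0 < C ∧
      ∀ m ∈ Set.Icc m_min m_max,
      ∀ X : Finset (Space d), (X : Set (Space d)) ⊆ Ω → X.Nontrivial →
      ∀ Y : X → ℝ,
      ∀ (N : Type) [NormedAddCommGroup N] [InnerProductSpace ℝ N] [CompleteSpace N]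
        [RKHS ℝ N (Space d) ℝ], IsNativeSpace N (Φ m) →
        (∃! u : N, IsKernelInterpolant X Y u) ∧
        (∀ t : ℝ, 0 < t → ∃! f : L2 d, IsMinBandLimited (κ / sepDist X) t X Y f) ∧
        ∀ (u : N) (f_s f_m : L2 d),
          IsKernelInterpolant X Y u →
          IsMinBandLimited (κ / sepDist X) (min s m) X Y f_s →
          IsMinBandLimited (κ / sepDist X) m X Y f_m →
          IntervalIntegrable
            (fun t : ℝ => Real.log
              (1 + (spectralMedian (κ / sepDist X) t f_m * (κ / sepDist X)) ^ 2))
            MeasureTheory.volume (min s m) m ∧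
          C * sobolevNorm (min s m) f_s *
              Real.exp (1 / 4 * ∫ t in (min s m)..m, Real.log
                (1 + (spectralMedian (κ / sepDist X) t f_m * (κ / sepDist X)) ^ 2))
            ≤ ‖u‖ := by
  obtain ⟨κ₀, hκ₀, H⟩ := exists_lowpass_bound d
  refine ⟨κ₀, hκ₀, fun κ hκ c₁ c₂ Φ hΦ Ω hΩ s hs => ?_⟩
  have hκ0 : 0 < κ := hκ₀.trans_le hκ
  obtain ⟨D, hD⟩ := Metric.isBounded_iff.1 hΩ
  obtain ⟨C, hC, H⟩ := H κ hκ m_min m_max h_min (κ / (|D| + 1)) (by positivity)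
  have hc₁ := hΦ.c₁_pos
  have hc₂ : 0 < c₂ := hc₁.trans_le hΦ.c₁_le_c₂
  have hK := fourierConst_pos (d := d)
  -- `L` is the ratio of the quadratic forms of `Φ_m` and of the band-limited kernel
  set L : ℝ := c₂ * C / fourierConst d with hL
  have hL0 : 0 < L := by positivity
  refine ⟨(Real.sqrt L)⁻¹, by positivity, ?_⟩
  intro m hm X hXΩ hX Y N _ _ _ _ hN
  have hq := sepDist_pos hX
  obtain ⟨hpos, hlow⟩ := forall_and.1 (H (sepDist X) hq X fun x hx y hy hxy =>
    two_mul_sepDist_le_dist hx hy hxy)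
  have hqD : sepDist X ≤ |D| + 1 := by
    obtain ⟨x, hx, y, hy, hxy⟩ := hX
    have h1 := two_mul_sepDist_le_dist hx hy hxy
    have h2 := hD (hXΩ hx) (hXΩ hy)
    linarith [le_abs_self D]
  have hσ₀ : κ / (|D| + 1) ≤ κ / sepDist X := by gcongr
  set σ := κ / sepDist X
  have hσ : 0 < σ := by positivity
  have hmd : (d : ℝ) / 2 < m := h_min.trans_le hm.1
  have hm0 : 0 < m := lt_of_le_of_lt (by positivity) hmd
  obtain ⟨Φhat, hmeas, hbd, hrep⟩ := hΦ.fourier_decay m hm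
  have hw := integrable_one_add_sq_rpow_neg hmd
  have hΦ0 : ∀ ω, 0 ≤ Φhat ω := fun ω => le_trans (by positivity) (hbd ω).1
  have hint : Integrable Φhat := (hw.const_mul c₂).mono' hmeas.aestronglyMeasurable
    (.of_forall fun ω => by rw [Real.norm_of_nonneg (hΦ0 ω)]; exact (hbd ω).2)
  have hform := sum_kernel_eq_integral hint hrep X
  have hposΦ : ∀ c : X → ℝ, c ≠ 0 → 0 < ∑ x : X, ∑ y : X, c x * c y * Φ m x y := by
    intro c hc
    rw [hform]
    refine mul_pos hK (lt_of_lt_of_le (mul_pos hc₁ (hpos c hc (-m))) ?_)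
    rw [← integral_const_mul]
    have hi : Integrable fun ω => c₁ * ((1 + ‖ω‖ ^ 2) ^ (-m) * ‖expSum X c ω‖ ^ 2) :=
      (integrable_mul_norm_expSum_sq X c hw).const_mul c₁
    refine (setIntegral_le_integral hi (.of_forall fun ω => by positivity)).trans
      (integral_mono hi (integrable_mul_norm_expSum_sq X c hint) fun ω => ?_)
    simp only [← mul_assoc]
    exact mul_le_mul_of_nonneg_right (hbd ω).1 (by positivity)
  have hle : ∀ c : X → ℝ, ∑ x : X, ∑ y : X, c x * c y * Φ m x y ≤
      L * ∑ x : X, ∑ y : X, c x * c y * bandKernel d σ m x y := by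
    intro c
    rw [hform, sum_bandKernel]
    calc fourierConst d * ∫ ω, Φhat ω * ‖expSum X c ω‖ ^ 2
        ≤ fourierConst d * ∫ ω, c₂ * ((1 + ‖ω‖ ^ 2) ^ (-m) * ‖expSum X c ω‖ ^ 2) := by
          refine mul_le_mul_of_nonneg_left (integral_mono
            (integrable_mul_norm_expSum_sq X c hint)
            ((integrable_mul_norm_expSum_sq X c hw).const_mul c₂) fun ω => ?_) hK.le
          simp only [← mul_assoc]
          exact mul_le_mul_of_nonneg_right (hbd ω).2 (by positivity)
      _ ≤ fourierConst d * (c₂ * (C * ∫ ω in Metric.closedBall 0 σ,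
            (1 + ‖ω‖ ^ 2) ^ (-m) * ‖expSum X c ω‖ ^ 2)) := by
          rw [integral_const_mul]
          exact mul_le_mul_of_nonneg_left
            (mul_le_mul_of_nonneg_left (hlow c m hm hσ₀) hc₂.le) hK.le
      _ = _ := by rw [hL]; field_simp
  refine ⟨existsUnique_isKernelInterpolant hN hposΦ Y,
    fun t _ => existsUnique_isMinBandLimited (fun c hc => hpos c hc (-t)) Y, ?_⟩
  intro u f_s f_m hu hfs hfm
  obtain ⟨hI, hprofile⟩ := sobolevNorm_mul_exp_le hσ hfm.mem (min_le_right s m)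
  refine ⟨hI, ?_⟩
  have h1 := sobolevNorm_le_sqrt_mul_norm hN hL0.le (fun c hc => hpos c hc (-m)) hle hu.interp hfm
  rw [mul_assoc, inv_mul_le_iff₀ (by positivity)]
  calc _ ≤ sobolevNorm (min s m) f_m * Real.exp (1 / 4 * ∫ t in (min s m)..m, Real.log
        (1 + (spectralMedian σ t f_m * σ) ^ 2)) :=
        mul_le_mul_of_nonneg_right (hfs.le f_m hfm.mem hfm.interp) (Real.exp_pos _).le
    _ ≤ sobolevNorm m f_m := hprofile
    _ ≤ _ := h1
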